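/- A scale is an increasing sequence $(p_k)_{k\ge1}$ of positive integers with $p_k\mid p_{k+1}$ for all $k$. Fix a scale with $p_1\ge 3$ and put $\rho=\sum_{k\ge1}\frac1{p_k}$ (so $\rho<1$). Given a sequence $y=(y_k)_{k\ge1}$ of symbols, define the one-sided sequence $x_y=(x_y(n))_{n\ge1}$ inductively: at step $k$ let $n_k$ be the first position $n\ge1$ not filled in steps $1,\dots,k-1$, and put $x_y(n)=y_k$ for all $n\ge1$ with $n\equiv n_k\pmod{p_k}$. (Every position gets filled exactly once.) The positions $n_1,n_2,\dots$, where the symbols $y_k$ are placed for the first time, are called boldface. Let $\boldsymbol\mu$ be the Möbius function, and let $y$ be chosen so that $x_y(n)=\boldsymbol\mu(n)$ at every boldface position $n$, i.e. $y_k=\boldsymbol\mu(n_k)$ for all $k$. Then: 1. $x_y$ is a one-sided Toeplitz sequence: for every $n\ge1$ there is $q\ge1$ with $x_y(n+mq)=x_y(n)$ for all $m\ge0$. 2. If $\rho<\frac3{\pi^2}$, then $x_y$ is strongly correlated with $\boldsymbol\mu$: $\liminf_{N\to\infty}\frac1N\sum_{n=1}^N x_y(n)\boldsymbol\mu(n)>0$.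 3. The two-sided subshift $X_y$ generated by $x_y$ (all two-sided sequences all of whose finite blocks occur in $x_y$) is a Toeplitz subshift, i.e. it is the closure of the shift orbit of a two-sided sequence $w=(w(n))_{n\in\mathbb Z}$ such that for every $n\in\mathbb Z$ there is $q\ge1$ with $w(n+mq)=w(n)$ for all $m\in\mathbb Z$. 4. If $\rho<\frac6{\pi^2}$ (in particular if $\rho<\frac3{\pi^2}$), then $X_y$ has positive topological entropy under the shift; the same holds for the one-sided orbit closure of $x_y$ under the one-sided shift. -/

import Mathlib

open Filter Topology

/-- A scale `p 0 < p 1 < p 2 < ⋯`: an increasing sequence of positive integers, each dividing the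
next one.  (Sequences `p_1, p_2, …` and `y_1, y_2, …` are indexed from `0` in the code: `p k` is
`p_{k+1}` and `y k` is `y_{k+1}`.  Positions in a one-sided sequence are the integers `n ≥ 1`; the
value at `n = 0` is never used.) -/
def IsScale (p : ℕ → ℕ) : Prop :=
  (∀ k, 0 < p k) ∧ StrictMono p ∧ ∀ k, p k ∣ p (k + 1)

/-- The number `ρ`, the sum of the inverses of the periods. -/
noncomputable def scaleRho (p : ℕ → ℕ) : ℝ := ∑' k, 1 / (p k : ℝ)

/-- The position of the first placement of the `k`-th symbol: the first position `n ≥ 1` still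
available after the earlier steps, where step `j` fills all `n ≥ 1` with
`n ≡ initialPos p j` modulo `p j`. -/
noncomputable def initialPos (p : ℕ → ℕ) (k : ℕ) : ℕ :=
  sInf {n : ℕ | 1 ≤ n ∧ ∀ j : Fin k, ¬ n ≡ initialPos p j.1 [MOD p j.1]}
termination_by k
decreasing_by exact j.2

/-- The step of the scheme at which the position `n` is filled. -/
noncomputable def schemeStep (p : ℕ → ℕ) (n : ℕ) : ℕ :=
  sInf {k : ℕ | n ≡ initialPos p k [MOD p k]}

/-- The one-sided sequence `x_y` associated with `y` and the scale `p`. -/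
noncomputable def schemeSeq {Λ : Type*} (p : ℕ → ℕ) (y : ℕ → Λ) (n : ℕ) : Λ :=
  y (schemeStep p n)

/-- `x_y(n)` is a boldface symbol: `n` is the first placement of one of the symbols. -/
def IsBoldface (p : ℕ → ℕ) (n : ℕ) : Prop := ∃ k, n = initialPos p k

/-- One-sided Toeplitz sequence (positions `n ≥ 1`). -/
def IsToeplitzOneSided {Λ : Type*} (x : ℕ → Λ) : Prop :=
  ∀ n : ℕ, 1 ≤ n → ∃ q : ℕ, 1 ≤ q ∧ ∀ m : ℕ, x (n + m * q) = x n

/-- Two-sided Toeplitz sequence. -/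
def IsToeplitzTwoSided {Λ : Type*} (w : ℤ → Λ) : Prop :=
  ∀ n : ℤ, ∃ q : ℕ, 1 ≤ q ∧ ∀ m : ℤ, w (n + m * q) = w n

/-- A (two-sided) Toeplitz subshift: the orbit closure of a two-sided Toeplitz sequence. -/
def IsToeplitzSubshift {Λ : Type*} [TopologicalSpace Λ] (X : Set (ℤ → Λ)) : Prop :=
  ∃ w : ℤ → Λ, IsToeplitzTwoSided w ∧
    X = closure (Set.range fun m : ℤ => SymbolicDynamics.FullShift.shift m w)

/-- The one-sided orbit closure of the one-sided sequence `x(1), x(2), …`; coordinate `i` of a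
point of `ℕ → Λ` corresponds to position `i + 1`. -/
def oneSidedOrbitClosure {Λ : Type*} [TopologicalSpace Λ] (x : ℕ → Λ) : Set (ℕ → Λ) :=
  closure (Set.range fun j : ℕ => fun i : ℕ => x (i + 1 + j))

/-- The two-sided subshift generated by the one-sided sequence `x(1), x(2), …`: all two-sided
sequences all of whose finite blocks occur in `x`. -/
def generatedSubshift {Λ : Type*} (x : ℕ → Λ) : Set (ℤ → Λ) :=
  {w | ∀ (i : ℤ) (L : ℕ), ∃ j : ℕ, 1 ≤ j ∧ ∀ t : ℕ, t < L → w (i + t) = x (j + t)}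

/-- Strong correlation of two real sequences: the lower limit of `(1/n) ∑_{i=1}^n ξ(i) η(i)` is
positive (lower limit in the extended reals). -/
def StronglyCorrelated (ξ η : ℕ → ℝ) : Prop :=
  0 < liminf (fun n : ℕ => (((1 / (n : ℝ)) * ∑ i ∈ Finset.Icc 1 n, ξ i * η i : ℝ) : EReal)) atTop

/-- Every step finds an available position, which lies in `[1, p k)`. -/
theorem initialPos_spec {p : ℕ → ℕ} (hp : IsScale p) (h3 : 3 ≤ p 0) (k : ℕ) :
    1 ≤ initialPos p k ∧ initialPos p k < p k ∧
      ∀ j, j < k → ¬ initialPos p k ≡ initialPos p j [MOD p j] := by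
  induction k using Nat.strong_induction_on with
  | _ k ih =>
  have key : ∃ n, (1 ≤ n ∧ ∀ j : Fin k, ¬ n ≡ initialPos p j.1 [MOD p j.1]) ∧ n < p k := by
    rcases k with _ | k
    · exact ⟨1, ⟨le_rfl, fun j => j.elim0⟩, by omega⟩
    · refine ⟨p k, ⟨hp.1 k, fun j hj => ?_⟩, hp.2.1 (Nat.lt_succ_self k)⟩
      obtain ⟨h1, h2, -⟩ := ih j.1 j.2
      have hd : p j.1 ∣ p k := by
        have : ∀ d, p j.1 ∣ p (j.1 + d) := fun d => by
          induction d with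
          | zero => exact dvd_rfl
          | succ d hd => exact hd.trans (hp.2.2 _)
        have hh := this (k - j.1)
        rwa [Nat.add_sub_cancel' (Nat.lt_succ_iff.1 j.2)] at hh
      have h0 : p j.1 ∣ initialPos p j.1 :=
        (Nat.modEq_zero_iff_dvd.1 (hj.symm.trans (Nat.modEq_zero_iff_dvd.2 hd)))
      exact absurd (Nat.le_of_dvd h1 h0) (by omega)
  obtain ⟨n, hn, hlt⟩ := key
  rw [initialPos]
  have hm := Nat.sInf_mem (s := {n : ℕ | 1 ≤ n ∧ ∀ j : Fin k, ¬ n ≡ initialPos p j.1 [MOD p j.1]})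
    ⟨n, hn⟩
  exact ⟨hm.1, lt_of_le_of_lt (Nat.sInf_le hn) hlt, fun j hj => hm.2 ⟨j, hj⟩⟩

/-- The scheme fills every position `n ≥ 1`, at exactly one step. -/
theorem existsUnique_step {p : ℕ → ℕ} (hp : IsScale p) (h3 : 3 ≤ p 0) {n : ℕ} (hn : 1 ≤ n) :
    ∃! k, n ≡ initialPos p k [MOD p k] := by
  have hdvd : ∀ j k, j ≤ k → p j ∣ p k := fun j k h => by
    induction h with
    | refl => exact dvd_rfl
    | step _ ih => exact ih.trans (hp.2.2 _)
  have huniq : ∀ j k, j < k → n ≡ initialPos p j [MOD p j] → ¬ n ≡ initialPos p k [MOD p k] :=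
    fun j k hjk hj hk =>
      (initialPos_spec hp h3 k).2.2 j hjk ((hk.of_dvd (hdvd j k hjk.le)).symm.trans hj)
  have hex : ∃ k, n ≡ initialPos p k [MOD p k] := by
    by_contra hno
    push Not at hno
    have hle : ∀ k, initialPos p k ≤ n := fun k => by
      rw [initialPos]
      exact Nat.sInf_le ⟨hn, fun j => hno j⟩
    have hinj : Function.Injective (initialPos p) := by
      intro a b hab
      rcases lt_trichotomy a b with h | h | h
      · exact absurd (hab ▸ Nat.ModEq.refl _) ((initialPos_spec hp h3 b).2.2 a h)
      · exact h
      · exact absurd (hab ▸ Nat.ModEq.refl _) ((initialPos_spec hp h3 a).2.2 b h)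
    exact (Set.infinite_range_of_injective hinj)
      ((Set.finite_Iic n).subset (by rintro _ ⟨k, rfl⟩; exact hle k))
  obtain ⟨k, hk⟩ := hex
  refine ⟨k, hk, fun j hj => ?_⟩
  rcases lt_trichotomy j k with h | h | h
  · exact absurd hk (huniq j k h hj)
  · exact h
  · exact absurd hj (huniq k j h hk)

/-- The symbol `y k` stands exactly at the positions `n ≥ 1` congruent to its first placement
modulo `p k`. -/
theorem schemeSeq_eq {Λ : Type*} {p : ℕ → ℕ} (hp : IsScale p) (h3 : 3 ≤ p 0) (y : ℕ → Λ)
    {n k : ℕ} (hn : 1 ≤ n) (hk : n ≡ initialPos p k [MOD p k]) : schemeSeq p y n = y k := by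
  have h := Nat.sInf_mem (s := {k : ℕ | n ≡ initialPos p k [MOD p k]}) ⟨k, hk⟩
  exact congrArg y ((existsUnique_step hp h3 hn).unique h hk)

/-!
A position is *repeated* if it belongs to the class `n ≡ initialPos p k` modulo `p k` of some step
`k` without being `initialPos p k` itself; at all other positions the sequence `x` agrees with the
Möbius function. Since `initialPos p k < p k`, a position repeated at step `k` is at least `p k`,
and the repeated positions have upper density at most `ρ` (`card_repeated_le`).

*Correlation.* Every non-repeated squarefree position contributes `1` to `∑ x(n) μ(n)`, every
repeated one at least `-1`. The squarefree integers have density `6 / π ^ 2`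
(`eventually_card_squarefree_ge`), so the lower limit of the averages is at least
`6 / π ^ 2 - 2 ρ`.

*Toeplitz subshift.* The naive extension of `x` to `ℤ` leaves holes (for instance at `0`), so a
two-sided Toeplitz sequence with the blocks of `x` is obtained as a limit of translates of `x`
(`IsToeplitzOneSided.exists_twoSided`).

*Entropy.* It suffices to find, for each `L`, a set `G ⊆ [0, L)` with at least `c * L` elements such
that every subset `S` of `G` is the set of zeros of some block of `x` along `G`
(`coverEntropy_pos_of_independent`, `exists_independent_blocks`). Because `ρ < 6 / π ^ 2`, some
window `[a, a + L)` has at least `c * L` squarefree positions outside the classes of the first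
steps; these positions form `G`. Given `S`, the Chinese remainder theorem yields translates of the
window that repeat its residues modulo the square of a highly divisible `V`, which preserves both
properties as far as small moduli are concerned, and in which moreover `a + j` is divisible by the
square of a private large prime `q j` for each `j ∈ S`. These translates form an arithmetic
progression of difference `m = (V * ∏ q j) ^ 2`. A union bound
(`IsScale.exists_window_avoiding`) provides a translate that meets no class of a later step and no
multiple of `r ^ 2` for primes `r ∤ m`: there `x` agrees with `μ` on `G`, and `μ` vanishes exactly on
`S`. The scale may share factors with `m`, so that later classes can be dense along the progression;
`IsScale.sum_gcd_div_le` shows that this loss is bounded by the number of prime factors of `m`.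
-/

/-! ### A criterion for positive topological entropy -/

/-- If the coordinate `π` of points of `F` can be made zero or nonzero independently along a set of
times of positive density in every `[0, L)`, then the entropy is positive: these points form
dynamical nets of exponentially growing size. -/
theorem coverEntropy_pos_of_independent {X : Type*} [UniformSpace X] {T : X → X} {F : Set X}
    {π : X → ℤ} (hπ : UniformContinuous π) {c : ℝ} (hc : 0 < c)
    (h : ∀ L : ℕ, 1 ≤ L → ∃ G ⊆ Finset.range L, c * L ≤ G.card ∧
      ∀ S ⊆ G, ∃ u ∈ F, ∀ i ∈ G, π (T^[i] u) = 0 ↔ i ∈ S) :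
    0 < Dynamics.coverEntropy T F := by
  classical
  set U : SetRel X X := {z | π z.1 = π z.2} with hU
  have hUu : U ∈ uniformity X := by
    refine hπ (show {z : ℤ × ℤ | z.1 = z.2} ∈ uniformity ℤ from ?_)
    rw [DiscreteUniformity.eq_principal_setRelId]
    exact fun z hz => hz
  refine lt_of_lt_of_le ?_ (Dynamics.netEntropyEntourage_le_coverEntropy T F hUu)
  have hpos : (0 : EReal) < ENNReal.log ((2 : ENNReal) ^ c) := by
    rw [ENNReal.zero_lt_log_iff]
    exact ENNReal.one_lt_rpow (by norm_num) hc
  refine lt_of_lt_of_le hpos ?_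
  rw [← ExpGrowth.expGrowthSup_pow]
  refine ExpGrowth.expGrowthSup_eventually_monotone ?_
  filter_upwards [eventually_ge_atTop 1] with L hL
  obtain ⟨G, hGL, hcard, hS⟩ := h L hL
  have : Nonempty X := ⟨(hS ∅ (by simp)).choose⟩
  choose! u huF hu using hS
  have hinj : ∀ S ⊆ G, ∀ S' ⊆ G, (∀ i ∈ G, π (T^[i] (u S)) = π (T^[i] (u S'))) → S = S' := by
    intro S hS S' hS' hall
    ext i
    constructor
    · intro hi
      rw [← hu S' hS' i (hS hi), ← hall i (hS hi), hu S hS i (hS hi)]; exact hi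
    · intro hi
      rw [← hu S hS i (hS' hi), hall i (hS' hi), hu S' hS' i (hS' hi)]; exact hi
  have hnet : Dynamics.IsDynNetIn T F U L (G.powerset.image u : Finset X) := by
    refine ⟨?_, ?_⟩
    · intro v hv
      obtain ⟨S, hS, rfl⟩ := Finset.mem_image.1 (Finset.mem_coe.1 hv)
      exact huF S (Finset.mem_powerset.1 hS)
    · intro v hv v' hv' hne
      obtain ⟨S, hS, rfl⟩ := Finset.mem_image.1 (Finset.mem_coe.1 hv)
      obtain ⟨S', hS', rfl⟩ := Finset.mem_image.1 (Finset.mem_coe.1 hv')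
      refine Set.disjoint_left.2 fun z hz hz' => hne ?_
      rw [Dynamics.mem_ball_dynEntourage] at hz hz'
      congr 1
      refine hinj S (Finset.mem_powerset.1 hS) S' (Finset.mem_powerset.1 hS') fun i hi => ?_
      have hiL := Finset.mem_range.1 (hGL hi)
      exact Eq.trans (hz i hiL) (hz' i hiL).symm
  have hc2 : (G.powerset.image u).card = 2 ^ G.card := by
    rw [Finset.card_image_of_injOn, Finset.card_powerset]
    intro S hS S' hS' heq
    exact hinj S (Finset.mem_powerset.1 hS) S' (Finset.mem_powerset.1 hS') fun i _ => by
      rw [heq]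
  have hle := hnet.card_le_netMaxcard
  rw [hc2] at hle
  have hle' := ENat.toENNReal_mono hle
  refine le_trans ?_ hle'
  rw [← ENNReal.rpow_natCast, ← ENNReal.rpow_mul]
  calc (2 : ENNReal) ^ (c * L) ≤ 2 ^ (G.card : ℝ) :=
        ENNReal.rpow_le_rpow_of_exponent_le (by norm_num) hcard
    _ = _ := by rw [ENNReal.rpow_natCast]; simp

/-! ### Toeplitz sequences -/

theorem IsScale.dvd {p : ℕ → ℕ} (hp : IsScale p) {j k : ℕ} (h : j ≤ k) : p j ∣ p k := by
  induction h with
  | refl => exact dvd_rfl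
  | step _ ih => exact ih.trans (hp.2.2 _)

theorem IsScale.two_pow_le {p : ℕ → ℕ} (hp : IsScale p) (k : ℕ) : 2 ^ k ≤ p k := by
  induction k with
  | zero => exact hp.1 0
  | succ k ih =>
    obtain ⟨d, hd⟩ := hp.2.2 k
    have h1 : p k < p (k + 1) := hp.2.1 (Nat.lt_succ_self k)
    have h2 : 2 ≤ d := by
      by_contra hlt
      have : p k * d ≤ p k * 1 := Nat.mul_le_mul_left _ (by omega)
      omega
    calc 2 ^ (k + 1) = 2 ^ k * 2 := pow_succ _ _
      _ ≤ p k * d := Nat.mul_le_mul ih h2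
      _ = _ := hd.symm

theorem isToeplitzOneSided_schemeSeq {Λ : Type*} {p : ℕ → ℕ} (hp : IsScale p) (h3 : 3 ≤ p 0)
    (y : ℕ → Λ) : IsToeplitzOneSided (schemeSeq p y) := by
  intro n hn
  obtain ⟨k, hk, -⟩ := existsUnique_step hp h3 hn
  refine ⟨p k, hp.1 k, fun m => ?_⟩
  rw [schemeSeq_eq hp h3 y hn hk]
  refine schemeSeq_eq hp h3 y (by omega) ?_
  exact (show n + m * p k ≡ n [MOD p k] by simp [Nat.ModEq]).trans hk

/-- A point lies in the closure of a set of integer sequences iff it agrees on each finite window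
with a member of the set. -/
theorem mem_closure_iff_windows {Λ : Type*} [TopologicalSpace Λ] [DiscreteTopology Λ]
    {A : Set (ℤ → Λ)} {u : ℤ → Λ} :
    u ∈ closure A ↔ ∀ (i : ℤ) (L : ℕ), ∃ v ∈ A, ∀ t : ℕ, t < L → u (i + t) = v (i + t) := by
  classical
  rw [mem_closure_iff]
  constructor
  · intro h i L
    obtain ⟨v, hv, hvA⟩ := h (Set.pi ((Finset.range L).image fun t : ℕ => i + (t : ℤ) : Finset ℤ)
      fun j => {u j}) (isOpen_set_pi (Finset.finite_toSet _) fun _ _ => isOpen_discrete _)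
      (fun j _ => rfl)
    exact ⟨v, hvA, fun t ht => (hv (i + t) (Finset.mem_coe.2
      (Finset.mem_image.2 ⟨t, Finset.mem_range.2 ht, rfl⟩))).symm⟩
  · intro h o ho huo
    obtain ⟨I, s, hs, hsub⟩ := isOpen_pi_iff.1 ho u huo
    obtain ⟨B, hB⟩ : ∃ B : ℕ, ∀ j ∈ I, j.natAbs ≤ B :=
      ⟨I.sup Int.natAbs, fun j hj => Finset.le_sup hj⟩
    obtain ⟨v, hvA, hv⟩ := h (-B) (2 * B + 1)
    refine ⟨v, hsub fun j hj => ?_, hvA⟩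
    have h1 := hB j hj
    have h2 := hv (j + B).toNat (by omega)
    rw [show -(B : ℤ) + ((j + B).toNat : ℤ) = j by omega] at h2
    rw [← h2]; exact (hs j hj).2

/-- Every one-sided Toeplitz sequence has a two-sided Toeplitz sequence with the same finite
blocks: the limit of translates by a sequence of positions `a i`, where the next position is
congruent to `a i` modulo a common period of the first `2 * a i` symbols. -/
theorem IsToeplitzOneSided.exists_twoSided {Λ : Type*} {x : ℕ → Λ} (hx : IsToeplitzOneSided x) :
    ∃ w : ℤ → Λ, IsToeplitzTwoSided w ∧
      (∀ (i : ℤ) (L : ℕ), ∃ j : ℕ, 1 ≤ j ∧ ∀ t : ℕ, t < L → w (i + t) = x (j + t)) ∧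
      (∀ (j L : ℕ), 1 ≤ j → ∃ i : ℤ, ∀ t : ℕ, t < L → w (i + t) = x (j + t)) := by
  have hx' : ∀ n : ℕ, ∃ q : ℕ, 1 ≤ q ∧ (1 ≤ n → ∀ m : ℕ, x (n + m * q) = x n) := fun n => by
    rcases Nat.eq_zero_or_pos n with rfl | hn
    · exact ⟨1, le_rfl, fun h => by omega⟩
    · obtain ⟨q, hq, h⟩ := hx n hn
      exact ⟨q, hq, fun _ => h⟩
  choose q hq1 hq using hx'
  -- `P N` is a common period of the symbols at the positions `1, …, N`
  let P : ℕ → ℕ := fun N => ∏ n ∈ Finset.range (N + 1), q n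
  have hP1 : ∀ N, 1 ≤ P N := fun N => Nat.succ_le_of_lt (Finset.prod_pos fun n _ => hq1 n)
  have hPdvd : ∀ {N N'}, N ≤ N' → P N ∣ P N' := fun h =>
    Finset.prod_dvd_prod_of_subset _ _ _ (Finset.range_subset_range.2 (by omega))
  have hP : ∀ N n, 1 ≤ n → n ≤ N → ∀ m, x (n + m * P N) = x n := fun N n h1 h2 m => by
    obtain ⟨d, hd⟩ : q n ∣ P N := Finset.dvd_prod_of_mem _ (Finset.mem_range.2 (by omega))
    rw [hd, show n + m * (q n * d) = n + (m * d) * q n by ring]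
    exact hq n h1 _
  -- the positions `a i` at least double at each step
  obtain ⟨a, ha0, ha⟩ : ∃ a : ℕ → ℕ, a 0 = 1 ∧ ∀ i, a (i + 1) = a i + a i * P (2 * a i) :=
    ⟨fun i => Nat.rec 1 (fun _ b => b + b * P (2 * b)) i, rfl, fun _ => rfl⟩
  have hpos : ∀ i, i < a i := by
    intro i
    induction i with
    | zero => rw [ha0]; exact Nat.one_pos
    | succ i ih =>
      rw [ha]
      have := Nat.mul_le_mul_left (a i) (hP1 (2 * a i))
      omega
  have hmono : Monotone a := monotone_nat_of_le_succ fun i => by rw [ha]; omega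
  have hcong : ∀ i d, ∃ s, a (i + d) = a i + s * P (2 * a i) := by
    intro i d
    induction d with
    | zero => exact ⟨0, by simp⟩
    | succ d ih =>
      obtain ⟨s, hs⟩ := ih
      obtain ⟨r, hr⟩ : P (2 * a i) ∣ P (2 * a (i + d)) :=
        hPdvd (Nat.mul_le_mul_left _ (hmono (Nat.le_add_right _ _)))
      refine ⟨s + a (i + d) * r, ?_⟩
      rw [← add_assoc, ha, hr]
      nth_rewrite 1 [hs]
      ring
  let w : ℤ → Λ := fun n => x ((a n.natAbs : ℤ) + n).toNat
  have hw : ∀ (n : ℤ) (i : ℕ), n.natAbs ≤ i → w n = x ((a i : ℤ) + n).toNat := by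
    intro n i hi
    obtain ⟨d, rfl⟩ := Nat.exists_eq_add_of_le hi
    obtain ⟨s, hs⟩ := hcong n.natAbs d
    have h1 := hpos n.natAbs
    rw [show ((a (n.natAbs + d) : ℤ) + n).toNat
      = ((a n.natAbs : ℤ) + n).toNat + s * P (2 * a n.natAbs) by rw [hs]; omega]
    exact (hP _ _ (by omega) (by omega) _).symm
  refine ⟨w, ?_, ?_, ?_⟩
  · intro n
    refine ⟨P (2 * a n.natAbs), hP1 _, fun m => ?_⟩
    set Q := P (2 * a n.natAbs) with hQ
    obtain ⟨d, hd⟩ := Nat.exists_eq_add_of_le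
      (show n.natAbs ≤ (n + m * Q).natAbs + (m * Q).natAbs by omega)
    obtain ⟨s, hs⟩ := hcong n.natAbs (d + a n.natAbs)
    rw [← hQ] at hs
    have h1 := hpos n.natAbs
    have h2 := hpos (n.natAbs + (d + a n.natAbs))
    have h3 : (0 : ℤ) ≤ s + m := by
      by_contra hneg
      have h4 : ((s : ℤ) + m) * Q ≤ -1 * Q :=
        mul_le_mul_of_nonneg_right (by omega) (by positivity)
      have h5 : (a (n.natAbs + (d + a n.natAbs)) : ℤ) = a n.natAbs + s * Q := by
        rw [hs]; push_cast; ring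
      have h6 : ((s : ℤ) + m) * Q = s * Q + m * Q := by ring
      have h7 : (1 : ℤ) ≤ Q := by exact_mod_cast hP1 _
      omega
    rw [hw (n + m * Q) (n.natAbs + (d + a n.natAbs)) (by omega), hw n n.natAbs le_rfl]
    have h8 : ((a (n.natAbs + (d + a n.natAbs)) : ℤ) + (n + m * Q)).toNat
        = ((a n.natAbs : ℤ) + n).toNat + (s + m).toNat * Q := by
      have h9 : (((s + m).toNat * Q : ℕ) : ℤ) = s * Q + m * Q := by
        push_cast; rw [Int.toNat_of_nonneg h3]; ring
      have h5 : (a (n.natAbs + (d + a n.natAbs)) : ℤ) = a n.natAbs + s * Q := by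
        rw [hs]; push_cast; ring
      omega
    rw [h8]
    exact hP _ _ (by omega) (by omega) _
  · intro i L
    have h1 := hpos (i.natAbs + L)
    refine ⟨((a (i.natAbs + L) : ℤ) + i).toNat, by omega, fun t ht => ?_⟩
    rw [hw (i + t) (i.natAbs + L) (by omega)]
    congr 1
    omega
  · intro j L hj
    have h0 := hpos (j + L)
    refine ⟨(j : ℤ) - a (j + L), fun t ht => ?_⟩
    obtain ⟨s, hs⟩ := hcong (j + L) (j + 2 * L + a (j + L))
    rw [hw _ (j + L + (j + 2 * L + a (j + L))) (by omega)]
    rw [show ((a (j + L + (j + 2 * L + a (j + L))) : ℤ) + (j - a (j + L) + t)).toNat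
      = j + t + s * P (2 * a (j + L)) by rw [hs]; omega]
    exact hP _ _ (by omega) (by omega) _

theorem IsToeplitzOneSided.isToeplitzSubshift {Λ : Type*} [TopologicalSpace Λ]
    [DiscreteTopology Λ] {x : ℕ → Λ} (hx : IsToeplitzOneSided x) :
    IsToeplitzSubshift (generatedSubshift x) := by
  obtain ⟨w, hw, hwx, hxw⟩ := hx.exists_twoSided
  refine ⟨w, hw, ?_⟩
  ext u
  rw [mem_closure_iff_windows]
  constructor
  · intro hu i L
    obtain ⟨j, hj, h⟩ := hu i L
    obtain ⟨i', h'⟩ := hxw j L hj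
    refine ⟨_, ⟨i' - i, rfl⟩, fun t ht => ?_⟩
    rw [h t ht, ← h' t ht]
    exact congrArg w (by ring)
  · intro hu i L
    obtain ⟨_, ⟨m, rfl⟩, h⟩ := hu i L
    obtain ⟨j, hj, h'⟩ := hwx (m + i) L
    refine ⟨j, hj, fun t ht => ?_⟩
    rw [h t ht, ← h' t ht]
    exact congrArg w (by ring)

/-! ### Entropy of the subshifts of a Toeplitz sequence -/

/-- Blocks of a one-sided Toeplitz sequence are realized at the origin by points of both subshifts,
so independent zeros in the blocks yield positive entropy for both. -/
theorem coverEntropy_pos_of_independent_blocks {x : ℕ → ℤ} (hx : IsToeplitzOneSided x) {c : ℝ}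
    (hc : 0 < c) (h : ∀ L : ℕ, 1 ≤ L → ∃ G ⊆ Finset.range L, c * L ≤ G.card ∧
      ∀ S ⊆ G, ∃ a : ℕ, 1 ≤ a ∧ ∀ i ∈ G, x (a + i) = 0 ↔ i ∈ S) :
    0 < Dynamics.coverEntropy (SymbolicDynamics.FullShift.shift (1 : ℤ)) (generatedSubshift x) ∧
      0 < Dynamics.coverEntropy (SymbolicDynamics.FullShift.shift (1 : ℕ))
        (oneSidedOrbitClosure x) := by
  have hZ : ∀ (i : ℕ) (u : ℤ → ℤ),
      (SymbolicDynamics.FullShift.shift (1 : ℤ))^[i] u 0 = u i := by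
    intro i
    induction i with
    | zero => intro u; rfl
    | succ i ih =>
      intro u
      rw [Function.iterate_succ_apply, ih]
      exact congrArg u (by push_cast; ring)
  have hN : ∀ (i : ℕ) (u : ℕ → ℤ),
      (SymbolicDynamics.FullShift.shift (1 : ℕ))^[i] u 0 = u i := by
    intro i
    induction i with
    | zero => intro u; rfl
    | succ i ih =>
      intro u
      rw [Function.iterate_succ_apply, ih]
      exact congrArg u (by ring)
  obtain ⟨w, -, hwx, hxw⟩ := hx.exists_twoSided
  -- a block of `x` alone is not a point of the two-sided subshift; a translate of `w` extends it
  constructor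
  · refine coverEntropy_pos_of_independent (Pi.uniformContinuous_proj _ (0 : ℤ)) hc
      fun L hL => ?_
    obtain ⟨G, hG, hcard, hS⟩ := h L hL
    refine ⟨G, hG, hcard, fun S hSG => ?_⟩
    obtain ⟨a, ha1, ha⟩ := hS S hSG
    obtain ⟨j, hj⟩ := hxw a L ha1
    refine ⟨fun n => w (j + n), fun i l => ?_, fun i hi => ?_⟩
    · obtain ⟨b, hb1, hb⟩ := hwx (j + i) l
      exact ⟨b, hb1, fun t ht => by rw [← hb t ht, add_assoc]⟩
    · rw [hZ, hj i (Finset.mem_range.1 (hG hi)), ha i hi]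
  · refine coverEntropy_pos_of_independent (Pi.uniformContinuous_proj _ (0 : ℕ)) hc
      fun L hL => ?_
    obtain ⟨G, hG, hcard, hS⟩ := h L hL
    refine ⟨G, hG, hcard, fun S hSG => ?_⟩
    obtain ⟨a, ha1, ha⟩ := hS S hSG
    refine ⟨_, subset_closure ⟨a - 1, rfl⟩, fun i hi => ?_⟩
    rw [hN, ← ha i hi]
    exact iff_of_eq (congrArg (x · = 0) (show i + 1 + (a - 1) = a + i by omega))

/-! ### The density of squarefree integers -/

theorem sq_dvd_mul_sq_iff {a b d : ℕ} (ha : Squarefree a) (hb : b ≠ 0) :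
    d ^ 2 ∣ b ^ 2 * a ↔ d ∣ b := by
  constructor
  · intro h
    obtain ⟨g, d', b', hg, hcop, rfl, rfl⟩ := Nat.exists_coprime' (m := d) (n := b)
      (Nat.gcd_pos_of_pos_right _ (Nat.pos_of_ne_zero hb))
    have hg2 : 0 < g ^ 2 := by positivity
    have h1 : d' ^ 2 ∣ b' ^ 2 * a := by
      rw [mul_pow, mul_pow, mul_right_comm] at h
      exact Nat.dvd_of_mul_dvd_mul_right hg2 h
    have h2 : d' * d' ∣ a := by
      rw [← sq]; exact Nat.Coprime.dvd_of_dvd_mul_left (hcop.pow 2 2) h1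
    rw [Nat.isUnit_iff.1 (ha d' h2), one_mul]
    exact dvd_mul_left _ _
  · exact fun h => (pow_dvd_pow_of_dvd h 2).mul_right _

/-- The sum of `μ(d)` over all `d` with `d ^ 2 ∣ n` indicates the squarefree integers. -/
theorem sum_moebius_sq_dvd {n : ℕ} (hn : n ≠ 0) {D : ℕ} (hD : n ≤ D ^ 2) :
    ∑ d ∈ Finset.Icc 1 D, (if d ^ 2 ∣ n then ArithmeticFunction.moebius d else 0)
      = if Squarefree n then 1 else 0 := by
  classical
  obtain ⟨a, b, rfl, ha⟩ := Nat.sq_mul_squarefree n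
  have hb : b ≠ 0 := fun h => hn (by simp [h])
  have ha0 : a ≠ 0 := ha.ne_zero
  have hbD : b ≤ D := by
    refine (Nat.pow_le_pow_iff_left two_ne_zero).1 (le_trans ?_ hD)
    exact (Nat.le_mul_of_pos_right _ (Nat.pos_of_ne_zero ha0))
  simp_rw [sq_dvd_mul_sq_iff ha hb]
  rw [← Finset.sum_filter]
  have h1 : (Finset.Icc 1 D).filter (· ∣ b) = b.divisors := by
    ext d
    simp only [Finset.mem_filter, Finset.mem_Icc, Nat.mem_divisors]
    constructor
    · exact fun h => ⟨h.2, hb⟩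
    · exact fun h => ⟨⟨Nat.pos_of_dvd_of_pos h.1 (by omega),
        (Nat.le_of_dvd (by omega) h.1).trans hbD⟩, h.1⟩
  rw [h1]
  have h2 := congrArg (fun f => f b) ArithmeticFunction.moebius_mul_coe_zeta
  simp only [ArithmeticFunction.coe_mul_zeta_apply,
    ArithmeticFunction.one_apply] at h2
  rw [h2]
  congr 1
  refine propext ⟨?_, fun h => ?_⟩
  · rintro rfl; simpa using ha
  · exact Nat.isUnit_iff.1 (h b ⟨a, by ring⟩)

/-- The value `1 / ζ(2)` of the Dirichlet series of `μ`. -/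
theorem hasSum_moebius_div_sq :
    HasSum (fun d : ℕ => (ArithmeticFunction.moebius d : ℝ) / (d : ℝ) ^ 2) (6 / Real.pi ^ 2) := by
  have h2 : (1 : ℝ) < (2 : ℂ).re := by norm_num
  have hs := (ArithmeticFunction.LSeriesSummable_moebius_iff.2 h2).LSeriesHasSum
  have h := ArithmeticFunction.LSeries_zeta_mul_Lseries_moebius h2
  rw [ArithmeticFunction.LSeries_zeta_eq_riemannZeta h2, riemannZeta_two] at h
  have hpi : (Real.pi : ℂ) ≠ 0 := by exact_mod_cast Real.pi_ne_zero
  have hval : LSeries (fun n => ((ArithmeticFunction.moebius n : ℤ) : ℂ)) 2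
      = ((6 / Real.pi ^ 2 : ℝ) : ℂ) := by
    push_cast
    rw [eq_div_iff (pow_ne_zero _ hpi)]
    linear_combination 6 * h
  rw [hval] at hs
  have hs' := Complex.hasSum_re hs
  simp only [Complex.ofReal_re] at hs'
  convert hs' using 2 with d
  rcases eq_or_ne d 0 with rfl | hd
  · simp
  · rw [LSeries.term_of_ne_zero hd]
    norm_cast

/-- The squarefree integers have lower density at least `6 / π ^ 2`. -/
theorem eventually_card_squarefree_ge {ε : ℝ} (hε : 0 < ε) :
    ∀ᶠ N : ℕ in atTop,
      (6 / Real.pi ^ 2 - ε) * N ≤ (((Finset.Icc 1 N).filter Squarefree).card : ℝ) := by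
  have hcount : ∀ N : ℕ, (((Finset.Icc 1 N).filter Squarefree).card : ℝ)
      = ∑ d ∈ Finset.Icc 1 (N.sqrt + 1), (ArithmeticFunction.moebius d : ℝ) * (N / d ^ 2 : ℕ) := by
    intro N
    have h1 : (((Finset.Icc 1 N).filter Squarefree).card : ℤ)
        = ∑ d ∈ Finset.Icc 1 (N.sqrt + 1), ArithmeticFunction.moebius d * (N / d ^ 2 : ℕ) := by
      rw [Finset.card_filter]
      push_cast
      calc ∑ n ∈ Finset.Icc 1 N, (if Squarefree n then (1 : ℤ) else 0)
          = ∑ n ∈ Finset.Icc 1 N, ∑ d ∈ Finset.Icc 1 (N.sqrt + 1),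
              (if d ^ 2 ∣ n then ArithmeticFunction.moebius d else 0) := by
            refine Finset.sum_congr rfl fun n hn => ?_
            rw [Finset.mem_Icc] at hn
            refine (sum_moebius_sq_dvd (by omega) ?_).symm
            exact hn.2.trans (Nat.lt_succ_sqrt' N).le
        _ = _ := by
            rw [Finset.sum_comm]
            refine Finset.sum_congr rfl fun d _ => ?_
            rw [← Finset.sum_filter, Finset.sum_const, nsmul_eq_mul, mul_comm]
            congr 2
            rw [← Nat.Ioc_filter_dvd_card_eq_div]
            rfl
    simpa only [Int.cast_sum, Int.cast_mul, Int.cast_natCast]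
      using congrArg (fun z : ℤ => (z : ℝ)) h1
  have hsqrt : Tendsto (fun N : ℕ => N.sqrt + 1) atTop atTop := by
    refine tendsto_atTop.2 fun b => ?_
    filter_upwards [eventually_ge_atTop (b ^ 2)] with N hN
    exact (Nat.le_sqrt'.2 hN).trans (Nat.le_succ _)
  have hlim : Tendsto (fun N : ℕ => ∑ d ∈ Finset.Icc 1 (N.sqrt + 1),
      (ArithmeticFunction.moebius d : ℝ) / (d : ℝ) ^ 2) atTop (𝓝 (6 / Real.pi ^ 2)) := by
    have h1 := (hasSum_moebius_div_sq.tendsto_sum_nat.comp (tendsto_add_atTop_nat 1)).comp hsqrt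
    refine h1.congr fun N => ?_
    simp only [Function.comp]
    rw [Finset.range_eq_Ico, Finset.sum_eq_sum_Ico_succ_bot (by omega)]
    simp only [Nat.cast_zero, ArithmeticFunction.map_zero, Int.cast_zero, zero_div, zero_add]
    rfl
  have hev := hlim.eventually (lt_mem_nhds (show 6 / Real.pi ^ 2 - ε / 2 < 6 / Real.pi ^ 2 by
    linarith))
  obtain ⟨B, hB⟩ := exists_nat_gt (4 / ε)
  filter_upwards [hev, eventually_ge_atTop (B ^ 2), eventually_ge_atTop 1] with N hN hNB hN1
  have hS : (B : ℝ) ≤ N.sqrt := by exact_mod_cast Nat.le_sqrt'.2 hNB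
  have hSN : ((N.sqrt : ℝ)) ^ 2 ≤ N := by exact_mod_cast Nat.sqrt_le' N
  have hN1' : (1 : ℝ) ≤ N := by exact_mod_cast hN1
  have hS1 : (1 : ℝ) ≤ N.sqrt := by exact_mod_cast Nat.le_sqrt'.2 (by simpa using hN1)
  rw [hcount]
  -- rounding `N / d ^ 2` down costs at most one for each `d ≤ √N + 1`
  have hround : (∑ d ∈ Finset.Icc 1 (N.sqrt + 1),
      (ArithmeticFunction.moebius d : ℝ) / (d : ℝ) ^ 2) * N - (N.sqrt + 1)
      ≤ ∑ d ∈ Finset.Icc 1 (N.sqrt + 1),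
        (ArithmeticFunction.moebius d : ℝ) * (N / d ^ 2 : ℕ) := by
    have hone : ((N.sqrt : ℝ) + 1) = ∑ d ∈ Finset.Icc 1 (N.sqrt + 1), (1 : ℝ) := by simp
    rw [hone, Finset.sum_mul, ← Finset.sum_sub_distrib]
    refine Finset.sum_le_sum fun d hd => ?_
    have hd0 : 0 < d ^ 2 := by have := (Finset.mem_Icc.1 hd).1; positivity
    have hfloor1 : ((N / d ^ 2 : ℕ) : ℝ) ≤ N / (d : ℝ) ^ 2 := by
      exact Nat.cast_div_le.trans_eq (by rw [Nat.cast_pow])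
    have hfloor2 : N / (d : ℝ) ^ 2 - 1 ≤ ((N / d ^ 2 : ℕ) : ℝ) := by
      have := Nat.lt_div_mul_add (a := N) hd0
      have h' : (N : ℝ) < (N / d ^ 2 : ℕ) * (d : ℝ) ^ 2 + (d : ℝ) ^ 2 := by exact_mod_cast this
      have hd0' : (0 : ℝ) < (d : ℝ) ^ 2 := by exact_mod_cast hd0
      rw [sub_le_iff_le_add, div_le_iff₀ hd0']
      linarith
    have hmu : |(ArithmeticFunction.moebius d : ℝ)| ≤ 1 := by
      exact_mod_cast ArithmeticFunction.abs_moebius_le_one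
    have h3 : |(ArithmeticFunction.moebius d : ℝ) * (N / (d : ℝ) ^ 2 - (N / d ^ 2 : ℕ))| ≤ 1 := by
      rw [abs_mul]
      exact mul_le_one₀ hmu (abs_nonneg _) (by rw [abs_le]; constructor <;> linarith)
    have h4 := (abs_le.1 h3).2
    have h5 : (ArithmeticFunction.moebius d : ℝ) / (d : ℝ) ^ 2 * N
      = (ArithmeticFunction.moebius d : ℝ) * (N / (d : ℝ) ^ 2) := by ring
    rw [h5]
    linarith [mul_sub (ArithmeticFunction.moebius d : ℝ) (N / (d : ℝ) ^ 2) ((N / d ^ 2 : ℕ) : ℝ)]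
  have hmain := mul_le_mul_of_nonneg_right hN.le (show (0 : ℝ) ≤ N by positivity)
  have hsmall : (N.sqrt : ℝ) + 1 ≤ ε / 2 * N := by
    have h6 : 4 ≤ ε * N.sqrt := by
      rw [div_lt_iff₀ hε] at hB
      nlinarith
    nlinarith
  linarith

/-! ### Counting positions in residue classes -/

/-- Along a progression of difference `m`, a residue class modulo `p` is either missed or met with
density `gcd p m / p`. -/
theorem card_linear_modEq_le (m b c T : ℕ) {p : ℕ} (hp : 0 < p) :
    (((Finset.range T).filter fun t => m * t + b ≡ c [MOD p]).card : ℝ)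
      ≤ T * ((Nat.gcd p m : ℝ) / p) + 1 := by
  rcases ((Finset.range T).filter fun t => m * t + b ≡ c [MOD p]).eq_empty_or_nonempty with h | h
  · rw [h]; simp; positivity
  obtain ⟨t₀, ht₀⟩ := h
  have hg : 0 < Nat.gcd p m := Nat.gcd_pos_of_pos_left _ hp
  have hr : 0 < p / Nat.gcd p m := Nat.div_pos (Nat.gcd_le_left _ hp) hg
  have hsub : ((Finset.range T).filter fun t => m * t + b ≡ c [MOD p])
      ⊆ (Finset.range T).filter fun t => t ≡ t₀ [MOD p / Nat.gcd p m] := by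
    intro t ht
    rw [Finset.mem_filter] at ht ht₀ ⊢
    exact ⟨ht.1, Nat.ModEq.cancel_left_div_gcd hp
      (Nat.ModEq.add_right_cancel' b (ht.2.trans ht₀.2.symm))⟩
  have h1 := Finset.card_le_card hsub
  rw [← Nat.count_eq_card_filter_range (fun t => t ≡ t₀ [MOD p / Nat.gcd p m]),
    Nat.count_modEq_card _ hr] at h1
  have h2 : ((Finset.range T).filter fun t => m * t + b ≡ c [MOD p]).card
      ≤ T / (p / Nat.gcd p m) + 1 := h1.trans (by split_ifs <;> omega)
  have h3 : ((T / (p / Nat.gcd p m) : ℕ) : ℝ) ≤ T * ((Nat.gcd p m : ℝ) / p) := by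
    refine Nat.cast_div_le.trans_eq ?_
    rw [Nat.cast_div (Nat.gcd_dvd_left _ _) (by positivity)]
    field_simp
  have h4 : (((Finset.range T).filter fun t => m * t + b ≡ c [MOD p]).card : ℝ)
      ≤ (T / (p / Nat.gcd p m) : ℕ) + 1 := by exact_mod_cast h2
  linarith

theorem card_Icc_modEq_le (c N : ℕ) {p : ℕ} (hp : 0 < p) :
    (((Finset.Icc 1 N).filter fun n => n ≡ c [MOD p]).card : ℝ) ≤ N / p + 1 := by
  have h := card_linear_modEq_le 1 1 c N hp
  rw [Nat.gcd_one_right, Nat.cast_one, mul_one_div] at h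
  refine le_trans ?_ h
  norm_cast
  refine Finset.card_le_card_of_injOn (fun n => n - 1) (fun n hn => ?_) fun n hn n' hn' he => ?_
  · simp only [Finset.coe_filter, Finset.mem_Icc, Set.mem_ofPred_eq, Finset.mem_range] at hn ⊢
    refine ⟨by omega, ?_⟩
    rw [show 1 * (n - 1) + 1 = n by omega]; exact hn.2
  · simp only [Finset.coe_filter, Finset.mem_Icc, Set.mem_ofPred_eq] at hn hn' he
    omega

theorem IsScale.summable {p : ℕ → ℕ} (hp : IsScale p) : Summable fun k => 1 / (p k : ℝ) := by
  refine Summable.of_nonneg_of_le (fun k => by positivity) (fun k => ?_)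
    (summable_geometric_two)
  rw [div_pow, one_pow]
  exact one_div_le_one_div_of_le (by positivity) (by exact_mod_cast hp.two_pow_le k)

theorem IsScale.sum_le_scaleRho {p : ℕ → ℕ} (hp : IsScale p) (s : Finset ℕ) :
    ∑ k ∈ s, 1 / (p k : ℝ) ≤ scaleRho p :=
  hp.summable.sum_le_tsum s fun k _ => by positivity

/-- The positions that carry a repeated symbol have upper density at most `ρ`: since the first
placement of the `k`-th symbol is below `p k`, it is repeated at most `N / p k` times up to `N`. -/
theorem card_repeated_le {p : ℕ → ℕ} (hp : IsScale p) (h3 : 3 ≤ p 0) (N : ℕ) :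
    (Set.ncard {n | n ∈ Set.Icc 1 N ∧
      ∃ k, n ≡ initialPos p k [MOD p k] ∧ n ≠ initialPos p k} : ℝ) ≤ scaleRho p * N := by
  classical
  set B : Finset ℕ := (Finset.range N).biUnion fun k =>
    (Finset.Icc 1 (N / p k)).image fun j => initialPos p k + p k * j with hB
  have hsub : {n | n ∈ Set.Icc 1 N ∧
      ∃ k, n ≡ initialPos p k [MOD p k] ∧ n ≠ initialPos p k} ⊆ (B : Set ℕ) := by
    rintro n ⟨⟨h1, h2⟩, k, hk, hne⟩
    have hlt := (initialPos_spec hp h3 k).2.1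
    have hmod : n % p k = initialPos p k := by
      rw [hk, Nat.mod_eq_of_lt hlt]
    have hdiv := Nat.mod_add_div n (p k)
    rw [hmod] at hdiv
    have hpos : 1 ≤ n / p k := by
      by_contra h0
      rw [Nat.lt_one_iff.1 (not_le.1 h0)] at hdiv
      exact hne (by simpa using hdiv.symm)
    have hpn : p k ≤ n := by
      by_contra h0
      rw [Nat.div_eq_of_lt (by omega)] at hpos
      omega
    rw [hB, Finset.mem_coe, Finset.mem_biUnion]
    refine ⟨k, Finset.mem_range.2 ?_, Finset.mem_image.2 ⟨n / p k, Finset.mem_Icc.2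
      ⟨hpos, Nat.div_le_div_right h2⟩, hdiv⟩⟩
    exact (Nat.lt_two_pow_self).trans_le ((hp.two_pow_le k).trans (hpn.trans h2))
  have h1 : Set.ncard {n | n ∈ Set.Icc 1 N ∧
      ∃ k, n ≡ initialPos p k [MOD p k] ∧ n ≠ initialPos p k} ≤ ∑ k ∈ Finset.range N, N / p k := by
    refine (Set.ncard_le_ncard hsub (Finset.finite_toSet _)).trans ?_
    rw [Set.ncard_coe_finset]
    refine Finset.card_biUnion_le.trans (Finset.sum_le_sum fun k _ => ?_)
    exact Finset.card_image_le.trans (by simp)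
  calc _ ≤ ((∑ k ∈ Finset.range N, N / p k : ℕ) : ℝ) := by exact_mod_cast h1
    _ ≤ ∑ k ∈ Finset.range N, (1 / (p k : ℝ)) * N := by
        rw [Nat.cast_sum]
        exact Finset.sum_le_sum fun k _ => Nat.cast_div_le.trans_eq (by ring)
    _ ≤ _ := by
        rw [← Finset.sum_mul]
        exact mul_le_mul_of_nonneg_right (hp.sum_le_scaleRho _) (by positivity)

/-! ### Correlation with the Möbius function -/

section Moebius

variable {p : ℕ → ℕ} {y : ℕ → ℤ}

theorem schemeSeq_initialPos (hp : IsScale p) (h3 : 3 ≤ p 0) (y : ℕ → ℤ) (k : ℕ) :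
    schemeSeq p y (initialPos p k) = y k :=
  schemeSeq_eq hp h3 y (initialPos_spec hp h3 k).1 (Nat.ModEq.refl _)

/-- The sequence agrees with `μ` at all positions that are not repetitions of an earlier symbol. -/
theorem schemeSeq_eq_moebius (hp : IsScale p) (h3 : 3 ≤ p 0)
    (hy : ∀ n : ℕ, 1 ≤ n → IsBoldface p n → schemeSeq p y n = ArithmeticFunction.moebius n)
    {n : ℕ} (hn : 1 ≤ n)
    (hbold : ∀ k, n ≡ initialPos p k [MOD p k] → n = initialPos p k) :
    schemeSeq p y n = ArithmeticFunction.moebius n := by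
  obtain ⟨k, hk, -⟩ := existsUnique_step hp h3 hn
  exact hy n hn ⟨k, hbold k hk⟩

theorem abs_schemeSeq_le_one (hp : IsScale p) (h3 : 3 ≤ p 0)
    (hy : ∀ n : ℕ, 1 ≤ n → IsBoldface p n → schemeSeq p y n = ArithmeticFunction.moebius n)
    {n : ℕ} (hn : 1 ≤ n) : |schemeSeq p y n| ≤ 1 := by
  obtain ⟨k, hk, -⟩ := existsUnique_step hp h3 hn
  rw [schemeSeq_eq hp h3 y hn hk, ← schemeSeq_initialPos hp h3 y k,
    hy _ (initialPos_spec hp h3 k).1 ⟨k, rfl⟩]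
  exact ArithmeticFunction.abs_moebius_le_one

theorem stronglyCorrelated_moebius (hp : IsScale p) (h3 : 3 ≤ p 0)
    (hy : ∀ n : ℕ, 1 ≤ n → IsBoldface p n → schemeSeq p y n = ArithmeticFunction.moebius n)
    (hρ : scaleRho p < 3 / Real.pi ^ 2) :
    StronglyCorrelated (fun n => ((schemeSeq p y n : ℤ) : ℝ))
      (fun n => (ArithmeticFunction.moebius n : ℝ)) := by
  classical
  set c : ℝ := 6 / Real.pi ^ 2 - 2 * scaleRho p with hc
  have hc0 : 0 < c := by
    have : (6 : ℝ) / Real.pi ^ 2 = 2 * (3 / Real.pi ^ 2) := by ring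
    linarith
  have hpos : (0 : EReal) < ((c / 2 : ℝ) : EReal) := by exact_mod_cast half_pos hc0
  refine lt_of_lt_of_le hpos (le_liminf_of_le ?_ ?_)
  · isBoundedDefault
  filter_upwards [eventually_card_squarefree_ge (half_pos hc0), eventually_ge_atTop 1]
    with N hN hN1
  have hNpos : (0 : ℝ) < N := by exact_mod_cast hN1
  set R : Finset ℕ := (Finset.Icc 1 N).filter fun n =>
    ∃ k, n ≡ initialPos p k [MOD p k] ∧ n ≠ initialPos p k with hR
  have hRcard : (R.card : ℝ) ≤ scaleRho p * N := by
    have h := card_repeated_le hp h3 N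
    rwa [show {n | n ∈ Set.Icc 1 N ∧ ∃ k, n ≡ initialPos p k [MOD p k] ∧ n ≠ initialPos p k}
      = (R : Set ℕ) by ext n; simp [hR], Set.ncard_coe_finset] at h
  have hterm : ∀ n ∈ Finset.Icc 1 N, ((if Squarefree n then 1 else 0 : ℝ)
      - 2 * (if ∃ k, n ≡ initialPos p k [MOD p k] ∧ n ≠ initialPos p k then 1 else 0 : ℝ))
      ≤ ((schemeSeq p y n : ℤ) : ℝ) * (ArithmeticFunction.moebius n : ℝ) := by
    intro n hn
    have hn1 := (Finset.mem_Icc.1 hn).1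
    by_cases hrep : ∃ k, n ≡ initialPos p k [MOD p k] ∧ n ≠ initialPos p k
    · rw [if_pos hrep]
      have h1 : |((schemeSeq p y n : ℤ) : ℝ)| ≤ 1 := by
        exact_mod_cast abs_schemeSeq_le_one hp h3 hy hn1
      have h2 : |(ArithmeticFunction.moebius n : ℝ)| ≤ 1 := by
        exact_mod_cast ArithmeticFunction.abs_moebius_le_one
      have h3 : |((schemeSeq p y n : ℤ) : ℝ) * (ArithmeticFunction.moebius n : ℝ)| ≤ 1 := by
        rw [abs_mul]; exact mul_le_one₀ h1 (abs_nonneg _) h2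
      have h4 := (abs_le.1 h3).1
      split_ifs <;> linarith
    · rw [if_neg hrep]
      push Not at hrep
      rw [schemeSeq_eq_moebius hp h3 hy hn1 hrep]
      by_cases hsq : Squarefree n
      · have h1 : ((ArithmeticFunction.moebius n : ℤ) : ℝ) ^ 2 = 1 := by
          exact_mod_cast ArithmeticFunction.moebius_sq_eq_one_of_squarefree hsq
        rw [if_pos hsq]
        linarith [sq (ArithmeticFunction.moebius n : ℝ)]
      · rw [if_neg hsq]
        linarith [mul_self_nonneg (ArithmeticFunction.moebius n : ℝ)]
  have hsum := Finset.sum_le_sum hterm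
  rw [Finset.sum_sub_distrib, ← Finset.mul_sum, Finset.sum_boole, Finset.sum_boole] at hsum
  rw [EReal.coe_le_coe_iff, one_div, ← div_eq_inv_mul, le_div_iff₀ hNpos]
  have h5 : (6 / Real.pi ^ 2 - c / 2) * N - 2 * (scaleRho p * N) = c / 2 * N := by
    rw [hc]; ring
  rw [← hR] at hsum
  linarith

end Moebius

/-! ### Avoiding late residue classes along an arithmetic progression -/

theorem sq_le_four_mul_two_pow (k : ℕ) : k ^ 2 ≤ 4 * 2 ^ k := by
  induction k with
  | zero => simp
  | succ k ih =>
    rcases Nat.lt_or_ge k 3 with h | h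
    · interval_cases k <;> norm_num
    · rw [pow_succ 2 k]; nlinarith

theorem two_pow_cardFactors_le {n : ℕ} (hn : n ≠ 0) :
    2 ^ ArithmeticFunction.cardFactors n ≤ n := by
  have h := List.pow_card_le_prod (l := n.primeFactorsList) (n := 2)
    fun q hq => (Nat.prime_of_mem_primeFactorsList hq).two_le
  rwa [Nat.prod_primeFactorsList hn] at h

theorem cardFactors_le_of_dvd {d n : ℕ} (hn : n ≠ 0) (h : d ∣ n) :
    ArithmeticFunction.cardFactors d ≤ ArithmeticFunction.cardFactors n := by
  obtain ⟨e, rfl⟩ := h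
  rw [ArithmeticFunction.cardFactors_mul (left_ne_zero_of_mul hn) (right_ne_zero_of_mul hn)]
  exact Nat.le_add_right _ _

theorem cardFactors_lt_of_dvd_of_ne {d n : ℕ} (hn : n ≠ 0) (h : d ∣ n) (hne : d ≠ n) :
    ArithmeticFunction.cardFactors d < ArithmeticFunction.cardFactors n := by
  obtain ⟨e, rfl⟩ := h
  have he : 1 < e := by
    have h1 : e ≠ 0 := right_ne_zero_of_mul hn
    have h2 : e ≠ 1 := fun h => hne (by simp [h])
    omega
  rw [ArithmeticFunction.cardFactors_mul (left_ne_zero_of_mul hn) (right_ne_zero_of_mul hn)]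
  have := ArithmeticFunction.cardFactors_pos_iff_one_lt.2 he
  omega

section Avoid

variable {p : ℕ → ℕ}

theorem IsScale.gcd_div_succ_le (hp : IsScale p) (m k : ℕ) :
    (Nat.gcd (p (k + 1)) m : ℝ) / p (k + 1) ≤ (Nat.gcd (p k) m : ℝ) / p k := by
  have h0 : (0 : ℝ) < p k := by exact_mod_cast hp.1 k
  have h1 : (0 : ℝ) < p (k + 1) := by exact_mod_cast hp.1 (k + 1)
  obtain ⟨d, hd⟩ := hp.2.2 k
  have hd0 : 0 < d := Nat.pos_of_ne_zero fun h => (hp.1 (k + 1)).ne' (by rw [hd, h, mul_zero])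
  have h2 : Nat.gcd (p (k + 1)) m ≤ Nat.gcd (p k) m * d := by
    refine Nat.le_of_dvd (Nat.mul_pos (Nat.gcd_pos_of_pos_left _ (hp.1 k)) hd0) ?_
    rw [hd, Nat.gcd_comm, Nat.gcd_comm (p k)]
    exact (Nat.gcd_mul_right_dvd_mul_gcd m (p k) d).trans
      (Nat.mul_dvd_mul_left _ (Nat.gcd_dvd_right _ _))
  rw [div_le_div_iff₀ h1 h0, hd]
  have h3 : (Nat.gcd (p (k + 1)) m : ℝ) ≤ Nat.gcd (p k) m * d := by exact_mod_cast h2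
  rw [hd] at h3
  push_cast
  nlinarith

/-- Along a progression of difference `m`, the class modulo `p k` has relative density at most
`gcd (p k) m / p k`. These densities are halved at each step except when `gcd (p k) m` grows, which
happens at most `Ω(m)` times; hence the sum of the tail is controlled by its first term. -/
theorem IsScale.sum_gcd_div_le (hp : IsScale p) {m : ℕ} (hm : m ≠ 0) (A B : ℕ) :
    ∑ k ∈ Finset.Icc A B, (Nat.gcd (p k) m : ℝ) / p k
      ≤ 2 * (ArithmeticFunction.cardFactors m + 1) * ((Nat.gcd (p A) m : ℝ) / p A) := by
  set v : ℕ → ℝ := fun k => (Nat.gcd (p k) m : ℝ) / p k with hv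
  set Ω := ArithmeticFunction.cardFactors with hΩ
  have hv0 : ∀ k, 0 ≤ v k := fun k => by positivity
  rcases Nat.lt_or_ge B A with hlt | hle
  · rw [Finset.Icc_eq_empty (by omega), Finset.sum_empty]
    have := hv0 A
    positivity
  have hmono : Antitone v := antitone_nat_of_succ_le fun k => hp.gcd_div_succ_le m k
  have hg0 : ∀ k, Nat.gcd (p k) m ≠ 0 := fun k => (Nat.gcd_pos_of_pos_left _ (hp.1 k)).ne'
  -- the extra term `v B` pays for the next term whenever the density is halved
  have key : ∑ k ∈ Finset.Icc A B, v k + v B ≤ 2 * (Ω (Nat.gcd (p B) m) + 1) * v A := by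
    induction B, hle using Nat.le_induction with
    | base =>
      rw [Finset.Icc_self, Finset.sum_singleton]
      have h1 : (0 : ℝ) ≤ Ω (Nat.gcd (p A) m) := by positivity
      nlinarith [hv0 A, mul_nonneg h1 (hv0 A)]
    | succ B hle ih =>
      rw [Finset.sum_Icc_succ_top (by omega)]
      have hdvd : Nat.gcd (p B) m ∣ Nat.gcd (p (B + 1)) m :=
        Nat.gcd_dvd_gcd_of_dvd_left _ (hp.2.2 B)
      by_cases heq : Nat.gcd (p B) m = Nat.gcd (p (B + 1)) m
      · have h2 : 2 * v (B + 1) ≤ v B := by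
          obtain ⟨d, hd⟩ := hp.2.2 B
          have h3 : 2 * p B ≤ p (B + 1) := by
            have h4 : p B < p (B + 1) := hp.2.1 (Nat.lt_succ_self B)
            rw [hd] at h4 ⊢
            have h5 : 1 < d := by
              by_contra h6
              exact absurd (Nat.mul_le_mul_left (p B) (not_lt.1 h6)) (by omega)
            rw [mul_comm]; exact Nat.mul_le_mul_left _ h5
          have h6 : (2 : ℝ) * p B ≤ p (B + 1) := by exact_mod_cast h3
          have h7 : (0 : ℝ) < p B := by exact_mod_cast hp.1 B
          have h8 : (0 : ℝ) < p (B + 1) := by exact_mod_cast hp.1 (B + 1)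
          simp only [hv]
          rw [← heq, mul_div_assoc', div_le_div_iff₀ h8 h7]
          have h9 : (0 : ℝ) ≤ Nat.gcd (p B) m := by positivity
          nlinarith
        rw [← heq]
        linarith
      · have h2 : (Ω (Nat.gcd (p B) m) : ℝ) + 1 ≤ Ω (Nat.gcd (p (B + 1)) m) := by
          exact_mod_cast cardFactors_lt_of_dvd_of_ne (hg0 _) hdvd heq
        have h3 : v (B + 1) ≤ v A := hmono (by omega)
        have h4 : v (B + 1) ≤ v B := hmono (by omega)
        have h5 := mul_le_mul_of_nonneg_right h2 (hv0 A)
        nlinarith [hv0 B, hv0 A]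
  have h1 : (Ω (Nat.gcd (p B) m) : ℝ) ≤ Ω m := by
    exact_mod_cast cardFactors_le_of_dvd hm (Nat.gcd_dvd_right _ _)
  have h2 := mul_le_mul_of_nonneg_right h1 (hv0 A)
  have := hv0 B
  nlinarith

/-- Some window of a progression of difference `m` avoids all late residue classes and all
multiples of `q ^ 2` for the primes `q ∤ m`: a union bound over the first `T` terms of the
progression, where `T` is so large that the at most `√(m * T)` relevant moduli, each of which may
cost one extra term, are negligible. -/
theorem IsScale.exists_window_avoiding (hp : IsScale p) (c : ℕ → ℕ) {m b L A Q : ℕ} (hm : m ≠ 0)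
    (hb : 1 ≤ b) (hL : 1 ≤ L) (hQL : 8 * L ≤ Q) (hQ : ∀ q, q.Prime → ¬ q ∣ m → Q < q)
    (hA : L * (2 * (ArithmeticFunction.cardFactors m + 1) * ((Nat.gcd (p A) m : ℝ) / p A))
      ≤ 1 / 8) :
    ∃ t, ∀ i < L,
      (∀ k, A ≤ k → p k ≤ m * t + b + i → ¬ m * t + b + i ≡ c k [MOD p k]) ∧
      ∀ q, q.Prime → ¬ q ∣ m → ¬ q * q ∣ m * t + b + i := by
  classical
  by_contra hcon
  push Not at hcon
  -- all positions involved are at most `Y * T = (K / 2) ^ 2`, so both the relevant steps `k`, with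
  -- `k ^ 2 ≤ 4 * 2 ^ k ≤ 4 * p k`, and the relevant primes are at most `K`
  obtain ⟨Y, hY⟩ : ∃ Y, Y = m + b + L := ⟨_, rfl⟩
  obtain ⟨T, hT⟩ : ∃ T, T = 1024 * L ^ 2 * Y := ⟨_, rfl⟩
  obtain ⟨K, hK⟩ : ∃ K, K = 64 * L * Y := ⟨_, rfl⟩
  have hY1 : 1 ≤ Y := by omega
  have hT1 : 1 ≤ T := by rw [hT]; exact Nat.mul_pos (by positivity) hY1
  let E : ℕ → ℕ → Finset ℕ := fun i k =>
    (Finset.range T).filter fun t => m * t + (b + i) ≡ c k [MOD p k]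
  let D : ℕ → ℕ → Finset ℕ := fun i q =>
    (Finset.range T).filter fun t => m * t + (b + i) ≡ 0 [MOD q ^ 2]
  let J : Finset ℕ := (Finset.Ioc Q (max Q K)).filter fun q => q.Prime ∧ ¬ q ∣ m
  have hcover : Finset.range T ⊆ (Finset.range L).biUnion fun i =>
      ((Finset.Icc A K).biUnion (E i)) ∪ (J.biUnion (D i)) := by
    intro t ht
    have htT := Finset.mem_range.1 ht
    obtain ⟨i, hi, h⟩ := hcon t
    refine Finset.mem_biUnion.2 ⟨i, Finset.mem_range.2 hi, ?_⟩
    have hN : m * t + b + i ≤ Y * T := by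
      have h1 : m * t ≤ m * T := Nat.mul_le_mul_left _ htT.le
      have h2 : (b + L) * 1 ≤ (b + L) * T := Nat.mul_le_mul_left _ hT1
      have h3 : Y * T = m * T + (b + L) * T := by rw [hY]; ring
      omega
    have hYT : 4 * (Y * T) = K ^ 2 := by rw [hT, hK]; ring
    by_cases hk : ∀ k, A ≤ k → p k ≤ m * t + b + i → ¬ m * t + b + i ≡ c k [MOD p k]
    · obtain ⟨q, hqp, hqm, hdvd⟩ := h hk
      refine Finset.mem_union_right _ (Finset.mem_biUnion.2 ⟨q, ?_, ?_⟩)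
      · have h1 : q ^ 2 ≤ m * t + b + i := by
          rw [sq]; exact Nat.le_of_dvd (by omega) hdvd
        have h2 : q ≤ K := (Nat.pow_le_pow_iff_left two_ne_zero).1 (by omega)
        exact Finset.mem_filter.2 ⟨Finset.mem_Ioc.2
          ⟨hQ q hqp hqm, h2.trans (le_max_right _ _)⟩, hqp, hqm⟩
      · refine Finset.mem_filter.2 ⟨ht, Nat.modEq_zero_iff_dvd.2 ?_⟩
        rw [sq, ← add_assoc]; exact hdvd
    · push Not at hk
      obtain ⟨k, hAk, hpk, hmod⟩ := hk
      refine Finset.mem_union_left _ (Finset.mem_biUnion.2 ⟨k, ?_, ?_⟩)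
      · have h1 := sq_le_four_mul_two_pow k
        have h2 := hp.two_pow_le k
        have h3 : k ≤ K := (Nat.pow_le_pow_iff_left two_ne_zero).1 (by omega)
        exact Finset.mem_Icc.2 ⟨hAk, h3⟩
      · refine Finset.mem_filter.2 ⟨ht, ?_⟩
        rw [← add_assoc]; exact hmod
  have hQ0 : Q ≠ 0 := by omega
  have hLpos : (0 : ℝ) < L := by exact_mod_cast hL
  have hTpos : (0 : ℝ) < T := by exact_mod_cast hT1
  have hEsum : ∀ i, ((∑ k ∈ Finset.Icc A K, (E i k).card : ℕ) : ℝ)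
      ≤ T * (2 * (ArithmeticFunction.cardFactors m + 1) * ((Nat.gcd (p A) m : ℝ) / p A))
        + (K + 1) := by
    intro i
    rw [Nat.cast_sum]
    calc _ ≤ ∑ k ∈ Finset.Icc A K, (T * ((Nat.gcd (p k) m : ℝ) / p k) + 1) :=
          Finset.sum_le_sum fun k _ => card_linear_modEq_le m (b + i) (c k) T (hp.1 k)
      _ = T * (∑ k ∈ Finset.Icc A K, (Nat.gcd (p k) m : ℝ) / p k) + (Finset.Icc A K).card := by
          rw [Finset.sum_add_distrib, Finset.mul_sum]; simp
      _ ≤ _ := by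
          refine add_le_add (mul_le_mul_of_nonneg_left (hp.sum_gcd_div_le hm A K) hTpos.le) ?_
          have : (Finset.Icc A K).card ≤ K + 1 := by rw [Nat.card_Icc]; omega
          exact_mod_cast this
  have hDsum : ∀ i, ((∑ q ∈ J, (D i q).card : ℕ) : ℝ) ≤ T * (1 / (8 * L)) + K := by
    intro i
    rw [Nat.cast_sum]
    calc _ ≤ ∑ q ∈ J, (T * ((q : ℝ) ^ 2)⁻¹ + 1) := by
          refine Finset.sum_le_sum fun q hq => ?_
          obtain ⟨-, hqp, hqm⟩ := Finset.mem_filter.1 hq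
          have h1 := card_linear_modEq_le m (b + i) 0 T (p := q ^ 2) (pow_pos hqp.pos 2)
          have h2 : Nat.gcd (q ^ 2) m = 1 :=
            Nat.Coprime.pow_left 2 ((Nat.Prime.coprime_iff_not_dvd hqp).2 hqm)
          rw [h2] at h1
          refine h1.trans_eq ?_
          push_cast
          rw [one_div]
      _ = T * (∑ q ∈ J, ((q : ℝ) ^ 2)⁻¹) + J.card := by
          rw [Finset.sum_add_distrib, Finset.mul_sum]; simp
      _ ≤ _ := by
          refine add_le_add (mul_le_mul_of_nonneg_left ?_ hTpos.le) ?_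
          · calc ∑ q ∈ J, ((q : ℝ) ^ 2)⁻¹
                ≤ ∑ q ∈ Finset.Ioc Q (max Q K), ((q : ℝ) ^ 2)⁻¹ :=
                  Finset.sum_le_sum_of_subset_of_nonneg (Finset.filter_subset _ _)
                    fun _ _ _ => by positivity
              _ ≤ (Q : ℝ)⁻¹ - ((max Q K : ℕ) : ℝ)⁻¹ :=
                  sum_Ioc_inv_sq_le_sub hQ0 (le_max_left _ _)
              _ ≤ (Q : ℝ)⁻¹ := sub_le_self _ (by positivity)
              _ ≤ 1 / (8 * L) := by
                  rw [← one_div]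
                  exact one_div_le_one_div_of_le (by positivity) (by exact_mod_cast hQL)
          · have h1 : J.card ≤ max Q K - Q := by
              refine (Finset.card_filter_le _ _).trans ?_
              rw [Nat.card_Ioc]
            have h2 : J.card ≤ K := by omega
            exact_mod_cast h2
  have hcard : (T : ℝ) ≤ L * (T * (2 * (ArithmeticFunction.cardFactors m + 1)
      * ((Nat.gcd (p A) m : ℝ) / p A)) + (K + 1) + (T * (1 / (8 * L)) + K)) := by
    have h1 : T ≤ ∑ i ∈ Finset.range L,
        (∑ k ∈ Finset.Icc A K, (E i k).card + ∑ q ∈ J, (D i q).card) := by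
      calc T = (Finset.range T).card := (Finset.card_range T).symm
        _ ≤ _ := Finset.card_le_card hcover
        _ ≤ _ := Finset.card_biUnion_le
        _ ≤ _ := Finset.sum_le_sum fun i _ => (Finset.card_union_le _ _).trans
            (add_le_add Finset.card_biUnion_le Finset.card_biUnion_le)
    calc (T : ℝ) ≤ ((∑ i ∈ Finset.range L,
        (∑ k ∈ Finset.Icc A K, (E i k).card + ∑ q ∈ J, (D i q).card) : ℕ) : ℝ) := by
          exact_mod_cast h1
      _ ≤ ∑ i ∈ Finset.range L, (T * (2 * (ArithmeticFunction.cardFactors m + 1)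
          * ((Nat.gcd (p A) m : ℝ) / p A)) + (K + 1) + (T * (1 / (8 * L)) + K)) := by
          rw [Nat.cast_sum]
          refine Finset.sum_le_sum fun i _ => ?_
          rw [Nat.cast_add]
          exact add_le_add (hEsum i) (hDsum i)
      _ = _ := by rw [Finset.sum_const, Finset.card_range, nsmul_eq_mul]
  have hmain : (L : ℝ) * (T * (2 * (ArithmeticFunction.cardFactors m + 1)
      * ((Nat.gcd (p A) m : ℝ) / p A))) ≤ T * (1 / 8) := by
    have := mul_le_mul_of_nonneg_left hA hTpos.le
    linarith
  have h8 : (L : ℝ) * (T * (1 / (8 * L))) = T * (1 / 8) := by field_simp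
  have hKT : (L : ℝ) * (2 * K + 1) < T / 2 := by
    have hYr : (1 : ℝ) ≤ Y := by exact_mod_cast hY1
    have hLr : (1 : ℝ) ≤ L := by exact_mod_cast hL
    rw [hT, hK]
    push_cast
    have h9 : (L : ℝ) ≤ (L : ℝ) ^ 2 * Y := by nlinarith [mul_le_mul hLr hYr]
    nlinarith
  nlinarith

end Avoid

/-! ### Windows with many squarefree positions -/

theorem card_filter_Icc_eq_count (g : ℕ → Prop) [DecidablePred g] (N : ℕ) :
    ((Finset.Icc 1 N).filter g).card = Nat.count (fun n => g (n + 1)) N := by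
  rw [Nat.count_eq_card_filter_range]
  refine (Finset.card_bij (fun n _ => n + 1) ?_ ?_ ?_).symm
  · intro n hn
    simp only [Finset.mem_filter, Finset.mem_range, Finset.mem_Icc] at hn ⊢
    exact ⟨⟨by omega, by omega⟩, hn.2⟩
  · intro n _ n' _ h
    exact Nat.succ_injective h
  · intro n hn
    simp only [Finset.mem_filter, Finset.mem_Icc] at hn
    refine ⟨n - 1, ?_, by omega⟩
    simp only [Finset.mem_filter, Finset.mem_range]
    rw [show n - 1 + 1 = n by omega]
    exact ⟨by omega, hn.2⟩

/-- A set of lower density at least `c` has a window of each length `L` with at least `c * L`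
points, by the pigeonhole principle. -/
theorem exists_window_card_ge (g : ℕ → Prop) [DecidablePred g] {c : ℝ}
    (h : ∀ᶠ N : ℕ in atTop, c * N ≤ (((Finset.Icc 1 N).filter g).card : ℝ)) {L : ℕ}
    (hL : 1 ≤ L) :
    ∃ a, 1 ≤ a ∧ c * L ≤ (((Finset.range L).filter fun i => g (a + i)).card : ℝ) := by
  by_contra hcon
  push Not at hcon
  have hwin : ∀ J : ℕ, (Nat.count (fun n => g (n + 1)) (L * (J + 1)) : ℝ) < c * L * (J + 1) := by
    intro J
    have hstep : ∀ j : ℕ,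
        (Nat.count (fun k => g (L * j + k + 1)) L : ℝ) < c * L := fun j => by
      refine lt_of_eq_of_lt ?_ (hcon (L * j + 1) (by omega))
      rw [Nat.count_eq_card_filter_range]
      simp only [add_right_comm]
    induction J with
    | zero => simpa using hstep 0
    | succ J ih =>
      rw [show L * (J + 1 + 1) = L * (J + 1) + L by ring, Nat.count_add]
      have := hstep (J + 1)
      push_cast at this ⊢
      linarith
  obtain ⟨N, hN⟩ := eventually_atTop.1 h
  have h1 := hN (L * (N + 1)) ((Nat.le_succ N).trans (Nat.le_mul_of_pos_left _ hL))
  rw [card_filter_Icc_eq_count] at h1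
  have h2 := hwin N
  push_cast at h1
  linarith

section Independent

variable {p : ℕ → ℕ} {y : ℕ → ℤ}

/-- The squarefree integers that avoid the classes of the steps `k ≤ K` and, for `K < k ≤ A`, the
larger classes of `initialPos p k` modulo `p K`, still have lower density at least `c`: the first
classes remove density at most `ρ`, the others at most `(A + 1) / p K`. The condition depends only
on the residue modulo `p K`, while it excludes the steps up to `A`. -/
theorem eventually_card_squarefree_avoiding_ge (hp : IsScale p) {c : ℝ} (hc : 0 < c)
    (hρ : scaleRho p + 4 * c ≤ 6 / Real.pi ^ 2) {A K : ℕ} (hAK : (A + 1 : ℝ) ≤ c * p K)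
    (g : ℕ → Prop) [DecidablePred g]
    (hg : ∀ n, g n ↔ Squarefree n ∧ ∀ k ≤ A, ¬ n ≡ initialPos p k [MOD p (min k K)]) :
    ∀ᶠ N : ℕ in atTop, c * N ≤ (((Finset.Icc 1 N).filter g).card : ℝ) := by
  obtain ⟨B, hB⟩ := exists_nat_gt ((A + 1 : ℝ) / c)
  filter_upwards [eventually_card_squarefree_ge hc, eventually_ge_atTop B] with N hN hNB
  have hNB' : (B : ℝ) ≤ N := by exact_mod_cast hNB
  rw [div_lt_iff₀ hc] at hB
  have hsub : (Finset.Icc 1 N).filter Squarefree ⊆ (Finset.Icc 1 N).filter g ∪ (Finset.range (A + 1)).biUnion fun k =>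
      (Finset.Icc 1 N).filter fun n => n ≡ initialPos p k [MOD p (min k K)] := by
    intro n hn
    rw [Finset.mem_filter] at hn
    by_cases h : ∀ k ≤ A, ¬ n ≡ initialPos p k [MOD p (min k K)]
    · exact Finset.mem_union_left _ (Finset.mem_filter.2 ⟨hn.1, (hg n).2 ⟨hn.2, h⟩⟩)
    · push Not at h
      obtain ⟨k, hk, hmod⟩ := h
      exact Finset.mem_union_right _ (Finset.mem_biUnion.2
        ⟨k, Finset.mem_range.2 (by omega), Finset.mem_filter.2 ⟨hn.1, hmod⟩⟩)
  have h1 : (((Finset.Icc 1 N).filter Squarefree).card : ℝ) ≤ ((Finset.Icc 1 N).filter g).card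
      + ∑ k ∈ Finset.range (A + 1),
        (((Finset.Icc 1 N).filter fun n => n ≡ initialPos p k [MOD p (min k K)]).card : ℝ) := by
    have h2 := (Finset.card_le_card hsub).trans ((Finset.card_union_le _ _).trans
      (Nat.add_le_add_left Finset.card_biUnion_le _))
    exact_mod_cast h2
  have hpK : (0 : ℝ) < p K := by exact_mod_cast hp.1 K
  have h2 : ∑ k ∈ Finset.range (A + 1),
      (((Finset.Icc 1 N).filter fun n => n ≡ initialPos p k [MOD p (min k K)]).card : ℝ)
      ≤ (scaleRho p + c) * N + (A + 1) := by
    calc _ ≤ ∑ k ∈ Finset.range (A + 1), ((1 / (p k : ℝ) + 1 / p K) * N + 1) := by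
          refine Finset.sum_le_sum fun k _ => (card_Icc_modEq_le _ N (hp.1 _)).trans ?_
          have h3 : 1 / (p (min k K) : ℝ) ≤ 1 / (p k : ℝ) + 1 / p K := by
            have h4 : (0 : ℝ) ≤ 1 / (p k : ℝ) := by positivity
            have h5 : (0 : ℝ) ≤ 1 / (p K : ℝ) := by positivity
            rcases min_choice k K with h | h <;> rw [h] <;> linarith
          have h4 := mul_le_mul_of_nonneg_right h3 (show (0 : ℝ) ≤ N by positivity)
          rw [one_div_mul_eq_div] at h4
          linarith
      _ = (∑ k ∈ Finset.range (A + 1), 1 / (p k : ℝ) + (A + 1) / p K) * N + (A + 1) := by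
          rw [Finset.sum_add_distrib, ← Finset.sum_mul, Finset.sum_add_distrib]
          simp [div_eq_mul_inv]
      _ ≤ _ := by
          have h6 := hp.sum_le_scaleRho (Finset.range (A + 1))
          have h7 : (A + 1 : ℝ) / p K ≤ c := (div_le_iff₀ hpK).2 hAK
          have h8 : (0 : ℝ) ≤ N := by positivity
          have := mul_le_mul_of_nonneg_right (add_le_add h6 h7) h8
          linarith
  have h3 : c * B ≤ c * N := mul_le_mul_of_nonneg_left hNB' hc.le
  have h4 := mul_le_mul_of_nonneg_right hρ (show (0 : ℝ) ≤ N by positivity)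
  nlinarith

theorem log_two_sq_le {n : ℕ} (hn : n ≠ 0) : Nat.log 2 n ^ 2 ≤ 4 * n :=
  (sq_le_four_mul_two_pow _).trans (Nat.mul_le_mul_left _ (Nat.pow_log_le_self 2 hn))

/-- With `W` fixed, `log (p K * W)` is negligible compared with `p K` for large `K`. -/
theorem IsScale.exists_log_lt (hp : IsScale p) {c : ℝ} (hc : 0 < c) {W : ℕ} (hW : 0 < W) :
    ∃ K, ((4 * (Nat.log 2 (p K * W) + 1) : ℕ) + 1 : ℝ) ≤ c * p K := by
  obtain ⟨K, hK⟩ := exists_nat_gt (10 / c + 256 * W / c ^ 2)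
  refine ⟨K, ?_⟩
  have hpK : (K : ℝ) ≤ p K := by
    exact_mod_cast (Nat.lt_two_pow_self).le.trans (hp.two_pow_le K)
  have hpos : (0 : ℝ) < p K := by exact_mod_cast hp.1 K
  have h1 : 10 / c < p K :=
    lt_of_le_of_lt (le_add_of_nonneg_right (by positivity)) (hK.trans_le hpK)
  have h2 : 256 * W / c ^ 2 < p K :=
    lt_of_le_of_lt (le_add_of_nonneg_left (by positivity)) (hK.trans_le hpK)
  rw [div_lt_iff₀ hc] at h1
  rw [div_lt_iff₀ (by positivity)] at h2
  have h3 : ((Nat.log 2 (p K * W) : ℕ) : ℝ) ^ 2 ≤ 4 * (p K * W) := by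
    exact_mod_cast log_two_sq_le (Nat.mul_pos (hp.1 K) hW).ne'
  push_cast
  by_contra hcon
  push Not at hcon
  have h4 : c * p K / 2 < 4 * (Nat.log 2 (p K * W) : ℝ) := by linarith
  have h5 : (c * p K / 2) ^ 2 < (4 * (Nat.log 2 (p K * W) : ℝ)) ^ 2 :=
    pow_lt_pow_left₀ h4 (by positivity) two_ne_zero
  have h6 := mul_lt_mul_of_pos_right h2 hpos
  nlinarith

/-- There are arbitrarily many distinct primes above any bound. -/
theorem exists_injective_primes_gt (B : ℕ) :
    ∃ q : ℕ → ℕ, Function.Injective q ∧ ∀ j, (q j).Prime ∧ B < q j := by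
  refine ⟨fun j => Nat.nth Nat.Prime (B + 1 + j), fun i j h => ?_, fun j =>
    ⟨Nat.prime_nth_prime _, ?_⟩⟩
  · have := (Nat.nth_strictMono Nat.infinite_setOfPred_prime).injective h
    omega
  · have := (Nat.nth_strictMono Nat.infinite_setOfPred_prime).le_apply (x := B + 1 + j)
    exact lt_of_lt_of_le (by omega) this

/-- A residue `b` that imitates `a` modulo `V ^ 2` and makes `b + j` divisible by the square of the
prime `q j` for each `j ∈ S`. -/
theorem exists_modEq_and_sq_dvd {q : ℕ → ℕ} (hinj : Function.Injective q)
    (hprime : ∀ j, (q j).Prime) {S : Finset ℕ} {V : ℕ} (hV : V ≠ 0)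
    (hcop : Nat.Coprime V (∏ j ∈ S, q j)) (a : ℕ) :
    ∃ b, 1 ≤ b ∧ b ≡ a [MOD V ^ 2] ∧ ∀ j ∈ S, q j ^ 2 ∣ b + j := by
  obtain ⟨b₀, hb₀⟩ := Nat.chineseRemainderOfFinset (fun j => q j ^ 2 * j - j)
    (fun j => q j ^ 2) S (fun j _ => pow_ne_zero 2 (hprime j).ne_zero)
    (fun i _ j _ hij => ((Nat.coprime_primes (hprime i) (hprime j)).2
      fun h => hij (hinj h)).pow 2 2)
  obtain ⟨b, hb1, hb2⟩ := Nat.chineseRemainder (hcop.pow 2 2) a b₀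
  have hQ0 : 1 ≤ V ^ 2 * (∏ j ∈ S, q j) ^ 2 :=
    Nat.mul_pos (by positivity) (pow_pos (Finset.prod_pos fun j _ => (hprime j).pos) 2)
  refine ⟨b + V ^ 2 * (∏ j ∈ S, q j) ^ 2, by omega, ?_, fun j hj => ?_⟩
  · exact (show b + V ^ 2 * (∏ j ∈ S, q j) ^ 2 ≡ b [MOD V ^ 2] by simp [Nat.ModEq]).trans hb1
  · have h1 : q j ^ 2 ∣ (∏ j ∈ S, q j) ^ 2 := pow_dvd_pow_of_dvd (Finset.dvd_prod_of_mem q hj) 2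
    have h2 : q j ^ 2 ∣ b + j := by
      have h3 : b + j ≡ (q j ^ 2 * j - j) + j [MOD q j ^ 2] :=
        ((hb2.of_dvd h1).trans (hb₀ j hj)).add_right j
      rw [Nat.sub_add_cancel (Nat.le_mul_of_pos_left _ (pow_pos (hprime j).pos 2))] at h3
      exact Nat.modEq_zero_iff_dvd.1 (h3.trans (Nat.modEq_zero_iff_dvd.2 (dvd_mul_right _ _)))
    rw [add_right_comm]
    exact dvd_add h2 (h1.mul_left _)

theorem cardFactors_prod_primes {q : ℕ → ℕ} (hprime : ∀ j, (q j).Prime) (S : Finset ℕ) :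
    ArithmeticFunction.cardFactors (∏ j ∈ S, q j) = S.card := by
  classical
  induction S using Finset.induction_on with
  | empty => simp
  | insert j S hj ih =>
    rw [Finset.prod_insert hj, ArithmeticFunction.cardFactors_mul (hprime j).ne_zero
      (Finset.prod_ne_zero_iff.2 fun i _ => (hprime i).ne_zero), ih,
      ArithmeticFunction.cardFactors_apply_prime (hprime j), Finset.card_insert_of_notMem hj,
      add_comm]

/-- If `ρ < 6 / π ^ 2`, then every length `L` admits at least `c * L` places in a window where the
zeros of the sequence can be prescribed freely by moving the window. -/
theorem exists_independent_blocks (hp : IsScale p) (h3 : 3 ≤ p 0)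
    (hy : ∀ n : ℕ, 1 ≤ n → IsBoldface p n → schemeSeq p y n = ArithmeticFunction.moebius n)
    (hρ : scaleRho p < 6 / Real.pi ^ 2) :
    ∃ c : ℝ, 0 < c ∧ ∀ L : ℕ, 1 ≤ L → ∃ G ⊆ Finset.range L, c * L ≤ G.card ∧
      ∀ S ⊆ G, ∃ a : ℕ, 1 ≤ a ∧ ∀ i ∈ G, schemeSeq p y (a + i) = 0 ↔ i ∈ S := by
  classical
  obtain ⟨c, hcdef⟩ : ∃ c, c = (6 / Real.pi ^ 2 - scaleRho p) / 4 := ⟨_, rfl⟩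
  have hc : 0 < c := by rw [hcdef]; linarith
  refine ⟨c, hc, fun L hL => ?_⟩
  -- `p A ≥ 2 ^ A > V ^ 4` makes the classes of the steps from `A` on sparse along progressions of
  -- difference `V ^ 2`, while `A = O(log V)` is small compared with `p K`
  obtain ⟨Q, hQ⟩ : ∃ Q, Q = 80 * L := ⟨_, rfl⟩
  obtain ⟨K, hK⟩ := hp.exists_log_lt hc (Nat.factorial_pos Q)
  obtain ⟨V, hV⟩ : ∃ V, V = p K * Nat.factorial Q := ⟨_, rfl⟩
  obtain ⟨A, hA⟩ : ∃ A, A = 4 * (Nat.log 2 V + 1) := ⟨_, rfl⟩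
  rw [← hV, ← hA] at hK
  have hV0 : V ≠ 0 := hV ▸ (Nat.mul_pos (hp.1 K) (Nat.factorial_pos Q)).ne'
  have hQV : Q ≤ V := (Nat.self_le_factorial Q).trans (hV ▸ Nat.le_mul_of_pos_left _ (hp.1 K))
  obtain ⟨g, hg⟩ : ∃ g : ℕ → Prop, ∀ n, g n ↔ Squarefree n ∧
      ∀ k ≤ A, ¬ n ≡ initialPos p k [MOD p (min k K)] := ⟨_, fun _ => Iff.rfl⟩
  obtain ⟨a, ha1, ha⟩ := exists_window_card_ge g
    (eventually_card_squarefree_avoiding_ge hp hc (by rw [hcdef]; linarith) hK g hg) hL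
  set G := (Finset.range L).filter fun i => g (a + i) with hG
  refine ⟨G, Finset.filter_subset _ _, ha, fun S hSG => ?_⟩
  have hSL : S ⊆ Finset.range L := hSG.trans (Finset.filter_subset _ _)
  obtain ⟨q, hqinj, hq⟩ := exists_injective_primes_gt (V + p A + L)
  have hqprime : ∀ j, (q j).Prime := fun j => (hq j).1
  have hcopV : Nat.Coprime V (∏ j ∈ S, q j) := Nat.Coprime.prod_right fun j _ =>
    (Nat.coprime_of_lt_prime hV0 (by have := (hq j).2; omega) (hqprime j)).symm
  have hcopA : Nat.Coprime (p A) (∏ j ∈ S, q j) := Nat.Coprime.prod_right fun j _ =>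
    (Nat.coprime_of_lt_prime (hp.1 A).ne' (by have := (hq j).2; omega) (hqprime j)).symm
  have hprod0 : ∏ j ∈ S, q j ≠ 0 := Finset.prod_ne_zero_iff.2 fun j _ => (hqprime j).ne_zero
  obtain ⟨b, hb1, hba, hbS⟩ := exists_modEq_and_sq_dvd hqinj hqprime (S := S) hV0 hcopV a
  -- `m` is a square, so a prime dividing `m` does so with its square, and divisibility by that
  -- square is constant along the progression
  obtain ⟨m, hm⟩ : ∃ m, m = (V * ∏ j ∈ S, q j) ^ 2 := ⟨_, rfl⟩
  have hm0 : m ≠ 0 := hm ▸ pow_ne_zero 2 (mul_ne_zero hV0 hprod0)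
  have hVm : V ^ 2 ∣ m := hm ▸ pow_dvd_pow_of_dvd (dvd_mul_right _ _) 2
  have hqm : ∀ j ∈ S, q j ^ 2 ∣ m := fun j hj =>
    hm ▸ pow_dvd_pow_of_dvd ((Finset.dvd_prod_of_mem q hj).mul_left _) 2
  have hlarge : ∀ r, r.Prime → ¬ r ∣ m → Q < r := by
    intro r hr hrm
    by_contra hle
    refine hrm (dvd_trans ?_ hVm)
    refine dvd_trans ?_ (dvd_pow_self V two_ne_zero)
    exact hV ▸ ((hr.dvd_factorial).2 (not_lt.1 hle)).mul_left _
  have hsmall : L * (2 * (ArithmeticFunction.cardFactors m + 1)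
      * ((Nat.gcd (p A) m : ℝ) / p A)) ≤ 1 / 8 := by
    have hΩ : (ArithmeticFunction.cardFactors m : ℝ) ≤ 2 * (V + L) := by
      have h1 : ArithmeticFunction.cardFactors V ≤ V :=
        (Nat.lt_two_pow_self).le.trans (two_pow_cardFactors_le hV0)
      have h2 : S.card ≤ L := (Finset.card_le_card hSL).trans_eq (Finset.card_range L)
      have h4 : ArithmeticFunction.cardFactors m ≤ 2 * (V + L) := by
        rw [hm, ArithmeticFunction.cardFactors_pow,
          ArithmeticFunction.cardFactors_mul hV0 hprod0, cardFactors_prod_primes hqprime]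
        omega
      exact_mod_cast h4
    have hgcd : (Nat.gcd (p A) m : ℝ) ≤ (V : ℝ) ^ 2 := by
      have h1 : Nat.gcd (p A) m ≤ V ^ 2 := by
        rw [hm, mul_pow, Nat.Coprime.gcd_mul_right_cancel_right _ ((hcopA.pow_right 2).symm)]
        exact Nat.gcd_le_right _ (by positivity)
      exact_mod_cast h1
    have hpA : (V : ℝ) ^ 4 ≤ p A := by
      have h1 : V ^ 4 ≤ p A := by
        refine le_trans ?_ (hp.two_pow_le A)
        rw [hA, mul_comm, pow_mul]
        exact Nat.pow_le_pow_left (Nat.lt_pow_succ_log_self (by norm_num) V).le 4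
      exact_mod_cast h1
    have hVpos : (0 : ℝ) < V := by exact_mod_cast Nat.pos_of_ne_zero hV0
    have hLr : (1 : ℝ) ≤ L := by exact_mod_cast hL
    have hVL : 80 * (L : ℝ) ≤ V := by exact_mod_cast hQ ▸ hQV
    have hpApos : (0 : ℝ) < p A := by exact_mod_cast hp.1 A
    have hratio : (Nat.gcd (p A) m : ℝ) / p A ≤ 1 / (V : ℝ) ^ 2 := by
      rw [div_le_div_iff₀ hpApos (by positivity)]
      nlinarith [mul_le_mul_of_nonneg_right hgcd (show (0 : ℝ) ≤ (V : ℝ) ^ 2 by positivity)]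
    calc (L : ℝ) * (2 * (ArithmeticFunction.cardFactors m + 1) * ((Nat.gcd (p A) m : ℝ) / p A))
        ≤ L * (2 * (2 * (V + L) + 1) * (1 / (V : ℝ) ^ 2)) := by gcongr
      _ = L * (2 * (2 * (V + L) + 1)) / (V : ℝ) ^ 2 := by ring
      _ ≤ 1 / 8 := by
          rw [div_le_div_iff₀ (by positivity) (by norm_num)]
          nlinarith
  obtain ⟨t, ht⟩ := hp.exists_window_avoiding (initialPos p) (b := b) (A := A) (Q := Q) hm0 hb1 hL
    (by omega) hlarge hsmall
  refine ⟨m * t + b, by omega, fun i hi => ?_⟩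
  obtain ⟨hiL, hgi⟩ := Finset.mem_filter.1 hi
  obtain ⟨hisq, hiK⟩ := (hg _).1 hgi
  rw [Finset.mem_range] at hiL
  obtain ⟨htk, htq⟩ := ht i hiL
  have hmb : ∀ d, d ∣ m → m * t + b + i ≡ b + i [MOD d] := fun d hd =>
    Nat.ModEq.add_right i (by simpa using
      ((Nat.modEq_zero_iff_dvd.2 (hd.mul_right t)).add_right b))
  have hmodV : ∀ d, d ∣ V ^ 2 → m * t + b + i ≡ a + i [MOD d] := fun d hd =>
    (hmb d (hd.trans hVm)).trans ((hba.of_dvd hd).add_right i)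
  have hmoe : schemeSeq p y (m * t + b + i) = ArithmeticFunction.moebius (m * t + b + i) := by
    refine schemeSeq_eq_moebius hp h3 hy (by omega) fun k hk => ?_
    by_contra hne
    -- late steps are avoided by the choice of `t`, early ones by the choice of `a`
    rcases Nat.lt_or_ge A k with hlt | hge
    · refine htk k hlt.le ?_ hk
      by_contra hsmall
      exact hne (Nat.ModEq.eq_of_lt_of_lt hk (not_le.1 hsmall) (initialPos_spec hp h3 k).2.1)
    · refine hiK k hge ?_
      have hdV : p (min k K) ∣ V ^ 2 :=
        ((hp.dvd (min_le_right k K)).trans (hV ▸ dvd_mul_right _ _)).trans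
          (dvd_pow_self V two_ne_zero)
      exact (hmodV _ hdV).symm.trans (hk.of_dvd (hp.dvd (min_le_left k K)))
  -- it remains to see that `m * t + b + i` is squarefree exactly when `i ∉ S`
  rw [hmoe, ← not_iff_not, ← ne_eq, ArithmeticFunction.moebius_ne_zero_iff_squarefree]
  constructor
  · intro hsq hiS
    have h1 : q i ^ 2 ∣ m * t + b + i :=
      Nat.modEq_zero_iff_dvd.1 ((hmb _ (hqm i hiS)).trans (Nat.modEq_zero_iff_dvd.2 (hbS i hiS)))
    rw [sq] at h1
    exact (hqprime i).one_lt.ne' (Nat.isUnit_iff.1 (hsq _ h1))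
  · intro hiS
    rw [Nat.squarefree_iff_prime_squarefree]
    intro r hr hrdvd
    by_cases hrm : r ∣ m
    · rcases (Nat.Prime.dvd_mul hr).1 (hr.dvd_of_dvd_pow (hm ▸ hrm)) with hrV | hrq
      · have h1 : r * r ∣ V ^ 2 := by rw [sq]; exact mul_dvd_mul hrV hrV
        have h2 : r * r ∣ a + i := Nat.modEq_zero_iff_dvd.1
          ((hmodV _ h1).symm.trans (Nat.modEq_zero_iff_dvd.2 hrdvd))
        exact hr.one_lt.ne' (Nat.isUnit_iff.1 (hisq r h2))
      · obtain ⟨j, hj, hrj⟩ := (Prime.dvd_finsetProd_iff hr.prime _).1 hrq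
        obtain rfl : r = q j := (Nat.prime_dvd_prime_iff_eq hr (hqprime j)).1 hrj
        rw [← sq] at hrdvd
        have h1 : i ≡ j [MOD q j ^ 2] := Nat.ModEq.add_left_cancel' b
          (((hmb _ (hqm j hj)).symm.trans (Nat.modEq_zero_iff_dvd.2 hrdvd)).trans
            (Nat.modEq_zero_iff_dvd.2 (hbS j hj)).symm)
        have h2 : L ≤ q j ^ 2 := by
          have := (hq j).2
          nlinarith
        have hjL := Finset.mem_range.1 (hSL hj)
        have h4 := Nat.ModEq.eq_of_lt_of_lt h1 (by omega) (by omega)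
        exact hiS (h4 ▸ hj)
    · exact htq r hr hrm hrdvd

end Independent

theorem mainTheorem7 (p : ℕ → ℕ) (hp : IsScale p) (hp1 : 3 ≤ p 0) (y : ℕ → ℤ)
    (hy : ∀ n : ℕ, 1 ≤ n → IsBoldface p n →
      schemeSeq p y n = ArithmeticFunction.moebius n) :
    IsToeplitzOneSided (schemeSeq p y) ∧
    (scaleRho p < 3 / Real.pi ^ 2 →
      StronglyCorrelated (fun n => ((schemeSeq p y n : ℤ) : ℝ))
        (fun n => (ArithmeticFunction.moebius n : ℝ))) ∧
    IsToeplitzSubshift (generatedSubshift (schemeSeq p y)) ∧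
    (scaleRho p < 6 / Real.pi ^ 2 →
      0 < Dynamics.coverEntropy (SymbolicDynamics.FullShift.shift (1 : ℤ))
        (generatedSubshift (schemeSeq p y)) ∧
      0 < Dynamics.coverEntropy (SymbolicDynamics.FullShift.shift (1 : ℕ))
        (oneSidedOrbitClosure (schemeSeq p y))) := by
  have hx := isToeplitzOneSided_schemeSeq hp hp1 y
  refine ⟨hx, stronglyCorrelated_moebius hp hp1 hy, hx.isToeplitzSubshift, fun hρ => ?_⟩
  obtain ⟨c, hc, h⟩ := exists_independent_blocks hp hp1 hy hρ
  exact coverEntropy_pos_of_independent_blocks hx hc h
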